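/- Let $k\ge 1$ and $n\ge 0$ be integers and $V=[n]$. On $\{0,1,\dots,k\}$ put $i\sqcup i'=\max\{i,i'\}$ and $i\sqcap i'=\min\{i,i'\}$ if $i=0$, $i'=0$ or $i=i'$, and $i\sqcup i'=i\sqcap i'=0$ otherwise; extend $\sqcup,\sqcap$ entrywise to $\{0,\dots,k\}^V$. A function $f:\{0,\dots,k\}^V\to\mathbb R$ is $k$-submodular if $f(x)+f(y)\ge f(x\sqcup y)+f(x\sqcap y)$ for all $x,y\in\{0,\dots,k\}^V$. In online $k$-submodular maximization over $T$ rounds, in round $t=1,\dots,T$ the player, knowing $n,k,T$, (randomly) plays $x_t\in\{0,\dots,k\}^V$; then an adversary reveals a $k$-submodular function $f_t:\{0,\dots,k\}^V\to[0,1]$ to the player as a value oracle, and the player gains $f_t(x_t)$. The adversary is adaptive: $f_t$ may depend arbitrarily on the previously realized plays $x_1,\dots,x_{t-1}$ (and on the player's algorithm), but not on the random choices of round $t$. The $\tfrac12$-regret is $$\mathrm{regret}_{1/2}=\tfrac12\max_{o\in\{0,\dots,k\}^V}\sum_{t=1}^T f_t(o)-\sum_{t=1}^T f_t(x_t).$$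 Computation is in the randomized real RAM model: exact arithmetic ($+,-,\times,\div$) and comparison of real numbers, addition and truncated subtraction of array indices, and tosses of independent coins with computed bias, each at unit cost; a call of the value oracle costs at least $n$ steps. An algorithm is a single finite program (not depending on $n,k,T$). It runs in polynomial time if its initialization and each of its rounds take a number of steps that is at most a fixed polynomial in $n$ and $k$, for every adversary and every outcome of the coins. **Theorem.** There are a polynomial-time algorithm for online (not necessarily monotone) $k$-submodular maximization and an absolute constant $C$ such that for all $n\ge 0$, $k\ge1$, $T\ge 0$ and every adaptive adversary, the algorithm satisfies $$\mathbf E\big[\mathrm{regret}_{1/2}\big]\le C\,k\,n\,\sqrt T ,$$ where the expectation is over the randomness of the algorithm. (Adversaries that fix $f_1,\dots,f_T$ in advance are a special case.) -/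

import Mathlib

noncomputable section

namespace OnlineKSubmod

/-! ### `k`-submodular functions on `{0, …, k}^V`, `V = {0, …, n-1}` -/

/-- The points of `{0, 1, …, k}^V` with `|V| = n`. -/
abbrev Vec (n k : ℕ) : Type := Fin n → Fin (k + 1)

/-- The binary operation `⊔` on `{0, …, k}`. -/
def cup {k : ℕ} (i i' : Fin (k + 1)) : Fin (k + 1) :=
  if i = 0 ∨ i' = 0 ∨ i = i' then max i i' else 0

/-- The binary operation `⊓` on `{0, …, k}`. -/
def cap {k : ℕ} (i i' : Fin (k + 1)) : Fin (k + 1) :=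
  if i = 0 ∨ i' = 0 ∨ i = i' then min i i' else 0

/-- `f x + f y ≥ f (x ⊔ y) + f (x ⊓ y)` for all `x, y`, the operations being applied entrywise. -/
def KSubmodular {n k : ℕ} (f : Vec n k → ℝ) : Prop :=
  ∀ x y : Vec n k,
    f (fun j => cup (x j) (y j)) + f (fun j => cap (x j) (y j)) ≤ f x + f y

/-! ### The machine model

A randomized real RAM (unit-cost exact real arithmetic and comparisons, no rounding or floor) with
index arithmetic, biased coins and a value oracle, in the form of a small imperative language.
A program is a finite piece of syntax; its memory consists of two-dimensional arrays of natural
numbers and of real numbers, each array being named by a constant of the program. All loops are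
bounded `for` loops, so that every program halts. -/

/-- Memory contents, together with the number of steps performed so far. The counter `steps` cannot
be read by a program. -/
structure State where
  nat : ℕ → ℕ → ℕ → ℕ
  real : ℕ → ℕ → ℕ → ℝ
  steps : ℕ

namespace State

/-- Write `v` into the cell `(i, j)` of the natural-number array `a`. -/
def setNat (s : State) (a i j v : ℕ) : State :=
  { s with nat := fun a' i' j' => if a' = a ∧ i' = i ∧ j' = j then v else s.nat a' i' j' }

/-- Write `v` into the cell `(i, j)` of the real array `a`. -/
def setReal (s : State) (a i j : ℕ) (v : ℝ) : State :=
  { s with real := fun a' i' j' => if a' = a ∧ i' = i ∧ j' = j then v else s.real a' i' j' }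

/-- Perform `m` steps. -/
def tick (s : State) (m : ℕ) : State := { s with steps := s.steps + m }

/-- The vector stored in row `0` of the natural-number array `a`; entries above `k` are read
as `k`. -/
def vec (s : State) (n k a : ℕ) : Vec n k :=
  fun j => ⟨min (s.nat a 0 j) k, Nat.lt_succ_of_le (min_le_right _ _)⟩

end State

/-- Expressions with natural-number values. -/
inductive NExpr where
  | const (c : ℕ)
  | read (a : ℕ) (i j : NExpr)
  | add (e₁ e₂ : NExpr)
  | sub (e₁ e₂ : NExpr)

namespace NExpr

/-- The value of an expression; `sub` is truncated subtraction. -/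
def eval (s : State) : NExpr → ℕ
  | const c => c
  | read a i j => s.nat a (i.eval s) (j.eval s)
  | add e₁ e₂ => e₁.eval s + e₂.eval s
  | sub e₁ e₂ => e₁.eval s - e₂.eval s

/-- The number of steps for evaluating an expression: one for each of its nodes. -/
def cost : NExpr → ℕ
  | const _ => 1
  | read _ i j => i.cost + j.cost + 1
  | add e₁ e₂ => e₁.cost + e₂.cost + 1
  | sub e₁ e₂ => e₁.cost + e₂.cost + 1

end NExpr

/-- Expressions with real values. -/
inductive RExpr where
  | const (q : ℚ)
  | ofNat (e : NExpr)
  | read (a : ℕ) (i j : NExpr)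
  | add (e₁ e₂ : RExpr)
  | sub (e₁ e₂ : RExpr)
  | mul (e₁ e₂ : RExpr)
  | div (e₁ e₂ : RExpr)

namespace RExpr

/-- The value of an expression; a division by zero returns zero. -/
def eval (s : State) : RExpr → ℝ
  | const q => (q : ℝ)
  | ofNat e => (e.eval s : ℝ)
  | read a i j => s.real a (i.eval s) (j.eval s)
  | add e₁ e₂ => e₁.eval s + e₂.eval s
  | sub e₁ e₂ => e₁.eval s - e₂.eval s
  | mul e₁ e₂ => e₁.eval s * e₂.eval s
  | div e₁ e₂ => e₁.eval s / e₂.eval s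

/-- The number of steps for evaluating an expression: one for each of its nodes. -/
def cost : RExpr → ℕ
  | const _ => 1
  | ofNat e => e.cost + 1
  | read _ i j => i.cost + j.cost + 1
  | add e₁ e₂ => e₁.cost + e₂.cost + 1
  | sub e₁ e₂ => e₁.cost + e₂.cost + 1
  | mul e₁ e₂ => e₁.cost + e₂.cost + 1
  | div e₁ e₂ => e₁.cost + e₂.cost + 1

end RExpr

/-- Programs.
* `setNat a i j e`, `setReal a i j e`: the assignment `a[i][j] := e`.
* `coin a i j q`: toss a coin and set the natural number `a[i][j]` to `1` with probability `q` (cut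
  off to `[0, 1]`) and to `0` otherwise, independently of all other tosses.
* `query a i j b`: set the real number `a[i][j]` to the value of the oracle at the vector stored in
  the array `b`.
* `iteNat e₁ e₂ c d`, `iteReal e₁ e₂ c d`: if `e₁ ≤ e₂` then `c` else `d`.
* `forLoop v e c`: for `v[0][0] = 0, …, e - 1` do `c` (with `e` evaluated once, at the start). -/
inductive Cmd where
  | skip
  | setNat (a : ℕ) (i j : NExpr) (e : NExpr)
  | setReal (a : ℕ) (i j : NExpr) (e : RExpr)
  | coin (a : ℕ) (i j : NExpr) (q : RExpr)
  | query (a : ℕ) (i j : NExpr) (b : ℕ)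
  | seq (c d : Cmd)
  | iteNat (e₁ e₂ : NExpr) (c d : Cmd)
  | iteReal (e₁ e₂ : RExpr) (c d : Cmd)
  | forLoop (v : ℕ) (e : NExpr) (c : Cmd)

/-- The law of a coin that shows `true` with probability `q`, cut off to `[0, 1]`. -/
def coinLaw (q : ℝ) : PMF Bool :=
  PMF.ofFintype
    (fun b => cond b (ENNReal.ofReal (max 0 (min 1 q))) (1 - ENNReal.ofReal (max 0 (min 1 q))))
    (by simp)

/-- Run `body 0, …, body (m - 1)` one after the other. -/
def iterate (body : ℕ → State → PMF State) : ℕ → State → PMF State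
  | 0, s => PMF.pure s
  | m + 1, s => (iterate body m s).bind (body m)

/-- The law of the state after running a program, for the dimensions `n, k` and the value
oracle `f`. -/
def exec (n k : ℕ) (f : Vec n k → ℝ) : Cmd → State → PMF State
  | .skip, s => PMF.pure (s.tick 1)
  | .setNat a i j e, s =>
      PMF.pure ((s.setNat a (i.eval s) (j.eval s) (e.eval s)).tick (i.cost + j.cost + e.cost + 1))
  | .setReal a i j e, s =>
      PMF.pure ((s.setReal a (i.eval s) (j.eval s) (e.eval s)).tick (i.cost + j.cost + e.cost + 1))
  | .coin a i j q, s =>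
      (coinLaw (q.eval s)).bind fun b =>
        PMF.pure ((s.setNat a (i.eval s) (j.eval s) (cond b 1 0)).tick
          (i.cost + j.cost + q.cost + 1))
  | .query a i j b, s =>
      PMF.pure ((s.setReal a (i.eval s) (j.eval s) (f (s.vec n k b))).tick
        (i.cost + j.cost + n + 1))
  | .seq c d, s => (exec n k f c s).bind (exec n k f d)
  | .iteNat e₁ e₂ c d, s =>
      if e₁.eval s ≤ e₂.eval s then exec n k f c (s.tick (e₁.cost + e₂.cost + 1))
      else exec n k f d (s.tick (e₁.cost + e₂.cost + 1))
  | .iteReal e₁ e₂ c d, s =>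
      if e₁.eval s ≤ e₂.eval s then exec n k f c (s.tick (e₁.cost + e₂.cost + 1))
      else exec n k f d (s.tick (e₁.cost + e₂.cost + 1))
  | .forLoop v e c, s =>
      iterate (fun m s' => exec n k f c ((s'.setNat v 0 0 m).tick 1)) (e.eval s)
        (s.tick (e.cost + 1))

/-! ### The online protocol -/

/-- An online algorithm: `init` is run once, before the first round; in every round, `play` is run
and the vector then stored in array `0` is played; after the adversary has revealed the reward
function, `update` is run with this function as its value oracle. The memory persists. -/
structure OnlineAlgorithm where
  init : Cmd
  play : Cmd
  update : Cmd

/-- The initial memory: the numbers `n`, `k`, `T` stand in the arrays `1`, `2`, `3` (at position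
`(0, 0)`), and everything else is zero. -/
def initialState (n k T : ℕ) : State where
  nat := fun a i j =>
    if i = 0 ∧ j = 0 then (if a = 1 then n else if a = 2 then k else if a = 3 then T else 0) else 0
  real := fun _ _ _ => 0
  steps := 0

/-- An adaptive adversary: the reward function of a round may depend on the player's (realized)
plays in all previous rounds. Rounds are numbered from `0`. -/
abbrev Adversary (n k : ℕ) : Type := (t : ℕ) → (Fin t → Vec n k) → Vec n k → ℝ

/-- All reward functions are `k`-submodular with values in `[0, 1]`. -/
def Adversary.Valid {n k : ℕ} (adv : Adversary n k) : Prop :=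
  ∀ (t : ℕ) (h : Fin t → Vec n k),
    KSubmodular (adv t h) ∧ ∀ x : Vec n k, adv t h x ∈ Set.Icc (0 : ℝ) 1

/-- The joint law of the player's memory and of the sequence of plays after `t` rounds, when the
announced number of rounds is `T`. Before the reward function of the round is revealed, the oracle
carries no information (it is constantly zero). -/
def OnlineAlgorithm.run (A : OnlineAlgorithm) (n k T : ℕ) (adv : Adversary n k) :
    (t : ℕ) → PMF (State × (Fin t → Vec n k))
  | 0 => (exec n k (fun _ => 0) A.init (initialState n k T)).map fun s => (s, Fin.elim0)
  | t + 1 =>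
      (A.run n k T adv t).bind fun p =>
        (exec n k (fun _ => 0) A.play p.1).bind fun s =>
          (exec n k (adv t p.2) A.update s).map fun s' => (s', Fin.snoc p.2 (s.vec n k 0))

/-- The reward function of round `t` when the sequence of plays is `x`. -/
def reward {n k T : ℕ} (adv : Adversary n k) (x : Fin T → Vec n k) (t : Fin T) : Vec n k → ℝ :=
  adv t fun s : Fin (t : ℕ) => x (Fin.castLE t.is_lt.le s)

/-- The `α`-regret `α max_o ∑_t f_t(o) - ∑_t f_t(x_t)` when the sequence of plays is `x`. -/
def regret {n k T : ℕ} (α : ℝ) (adv : Adversary n k) (x : Fin T → Vec n k) : ℝ :=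
  α * Finset.univ.sup' Finset.univ_nonempty (fun o : Vec n k => ∑ t : Fin T, reward adv x t o)
    - ∑ t : Fin T, reward adv x t (x t)

/-- The expected `α`-regret over `T` rounds. -/
def OnlineAlgorithm.expectedRegret (A : OnlineAlgorithm) (n k T : ℕ) (α : ℝ)
    (adv : Adversary n k) : ℝ :=
  ∑ x : Fin T → Vec n k, (((A.run n k T adv T).map Prod.snd) x).toReal * regret α adv x

/-- Polynomial running time: against every adversary, and for every outcome of the coins, the
initialization and every single round take a number of steps that is bounded by a fixed polynomial
in `n` and `k`. -/
def OnlineAlgorithm.PolynomialTime (A : OnlineAlgorithm) : Prop :=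
  ∃ C d : ℕ, ∀ (n k T : ℕ), 1 ≤ k → ∀ adv : Adversary n k, adv.Valid →
    (∀ s ∈ (exec n k (fun _ => 0) A.init (initialState n k T)).support,
      s.steps ≤ C * (n + k) ^ d) ∧
    ∀ t < T, ∀ p ∈ (A.run n k T adv t).support,
      ∀ s ∈ (exec n k (fun _ => 0) A.play p.1).support,
        ∀ s' ∈ (exec n k (adv t p.2) A.update s).support,
          s'.steps ≤ p.1.steps + C * (n + k) ^ d

end OnlineKSubmod

end

/-! Each coordinate runs its own regret-matching learner over K = max(k, 2) labels, and the
coordinates are sampled one after the other. A learner keeps a vector G of regrets, normalizes its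
positive part to a distribution r, and plays `mix r`. Let y be the marginal gains of the labels
after the sampled prefix, and a the gains at a hybrid point that agrees with the play on this prefix
and with the comparator o afterwards. By k-submodularity the sum of any two gains is nonnegative, in
y and in a, and a ≤ y.

The game is tuned by E, the amount by which the largest entry of r exceeds 1/2. With p = `mix r` and
c = `coef r`, two inequalities hold. `IsDist.sub_avg_le`: replacing the comparator's label i by a
sample from p loses at most c_i a_i ≤ c_i y_i. `IsDist.sum_coef_mul_le`: ∑ r_i c_i y_i ≤ ∑ p_i y_i,
which is Blackwell's condition for the regret increments c_i y_i - ∑ p_l y_l. The first one,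
telescoped over the coordinates in `expect_seqLaw_le`, moves from o to the play and from the empty
labeling to the play at once; therefore f(o) - 2 E f(x) is bounded by the expected regret increments
of the labels of o. Where o is unlabeled, the average of two labels stands in for it. For k = 1
there is only one nonzero value, and double greedy takes over: the labels are "put in" and "leave
out", and the induced function is the sum of f over the lower and the upper completion.

Against an adaptive adversary the learner only sees realized increments, summing to G, while the
analysis needs their conditional expectations, summing to H. By Blackwell's condition the squares of
the positive parts of G grow by O(K) per round; H - G is a martingale with bounded increments, so
its expected squares grow at the same rate (`expect_coordPot_le`). The comparison with o
(`sum_reward_sub_le`) holds on every history, so the best o may be chosen in hindsight. No learning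
rate occurs, and the algorithm never reads T.

The rest concerns the program. `run_invariant` shows that the memory always holds the regrets,
probabilities and coefficients of the idealized process, `map_vec_play` that sampling has the right
law, so that `map_snd_run` identifies the laws of the plays; `steps_le_bound` bounds the running
time from the syntax. -/

noncomputable section

namespace OnlineKSubmod

/-! ### One coordinate: the mixed strategy against a regret vector -/

section Row

variable {ι : Type*} [Fintype ι]

/-- The positive part of a regret vector, normalized to a probability vector. -/
def posDist (G : ι → ℝ) (i : ι) : ℝ :=
  if ∑ l, max (G l) 0 ≤ 0 then 1 / (Fintype.card ι : ℝ) else max (G i) 0 / ∑ l, max (G l) 0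

/-- The amount by which a probability vector exceeds `1 / 2` in some entry. -/
def excess (r : ι → ℝ) : ℝ := ∑ i, max (r i - 1 / 2) 0

/-- The probabilities of the labels, for the normalized regret vector `r`. -/
def mix (r : ι → ℝ) (i : ι) : ℝ :=
  if r i ≤ 1 / 2 then r i * (1 + excess r) + excess r * excess r / ((Fintype.card ι : ℝ) - 1)
  else (1 + excess r) / 2

/-- The factor of the marginal gain of label `i` in the `i`-th regret. -/
def coef (r : ι → ℝ) (i : ι) : ℝ := if r i ≤ 1 / 2 then 1 + excess r else 1 - excess r

/-- All sums of two distinct entries are nonnegative. -/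
def PairNonneg (a : ι → ℝ) : Prop := ∀ i l, i ≠ l → 0 ≤ a i + a l

/-- A probability vector. -/
def IsDist (r : ι → ℝ) : Prop := (∀ i, 0 ≤ r i) ∧ ∑ i, r i = 1

theorem IsDist.le_one {r : ι → ℝ} (hr : IsDist r) (i : ι) : r i ≤ 1 := by
  rw [← hr.2]
  exact Finset.single_le_sum (fun l _ => hr.1 l) (Finset.mem_univ i)

theorem posDist_isDist [Nonempty ι] (G : ι → ℝ) : IsDist (posDist G) := by
  have hc : (Fintype.card ι : ℝ) ≠ 0 := by exact_mod_cast Fintype.card_ne_zero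
  by_cases h : ∑ l, max (G l) 0 ≤ 0
  · refine ⟨fun i => ?_, ?_⟩
    · rw [posDist, if_pos h]; positivity
    · simp [posDist, if_pos h, hc]
  · refine ⟨fun i => ?_, ?_⟩
    · rw [posDist, if_neg h]
      exact div_nonneg (le_max_right _ _) (not_le.mp h).le
    · simp only [posDist, if_neg h]
      rw [← Finset.sum_div, div_self (not_le.mp h).ne']

theorem excess_nonneg (r : ι → ℝ) : 0 ≤ excess r :=
  Finset.sum_nonneg fun _ _ => le_max_right _ _

theorem excess_eq_zero {r : ι → ℝ} (h : ∀ i, r i ≤ 1 / 2) : excess r = 0 :=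
  Finset.sum_eq_zero fun i _ => max_eq_right (by linarith [h i])

/-- Two entries above 1/2 would sum to more than 1. So there is at most one heavy label m, and the
arguments below split on whether it exists. -/
theorem IsDist.le_half_of_ne [DecidableEq ι] {r : ι → ℝ} (hr : IsDist r) {m i : ι}
    (hm : ¬ r m ≤ 1 / 2) (hi : i ≠ m) : r i ≤ 1 / 2 := by
  have h : ∑ l ∈ {i, m}, r l ≤ ∑ l, r l :=
    Finset.sum_le_sum_of_subset_of_nonneg (Finset.subset_univ _) fun l _ _ => hr.1 l
  rw [Finset.sum_pair hi, hr.2] at h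
  linarith

theorem IsDist.excess_eq [DecidableEq ι] {r : ι → ℝ} (hr : IsDist r) {m : ι}
    (hm : ¬ r m ≤ 1 / 2) : excess r = r m - 1 / 2 := by
  rw [excess, Finset.sum_eq_single m]
  · exact max_eq_left (by linarith)
  · exact fun i _ hi => max_eq_right (by linarith [hr.le_half_of_ne hm hi])
  · simp

theorem IsDist.excess_le {r : ι → ℝ} (hr : IsDist r) : excess r ≤ 1 / 2 := by
  classical
  by_cases h : ∀ i, r i ≤ 1 / 2
  · rw [excess_eq_zero h]; norm_num
  · obtain ⟨m, hm⟩ := not_forall.mp h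
    rw [hr.excess_eq hm]
    linarith [hr.le_one m]

theorem IsDist.coef_mem {r : ι → ℝ} (hr : IsDist r) (i : ι) : 0 ≤ coef r i ∧ coef r i ≤ 2 := by
  have h1 := hr.excess_le
  have h0 := excess_nonneg r
  unfold coef
  split_ifs <;> constructor <;> linarith

/-- The weights r_i · `coef r i` have total 1 - 2E², where E is the excess. The missing mass goes
back in two equal halves: E² to the heavy label, E² spread evenly over the others. This shape makes
the difference a combination of pair sums in `IsDist.sum_coef_mul_le`. -/
theorem IsDist.mix_sub [DecidableEq ι] {r : ι → ℝ} (hr : IsDist r) {m : ι} (hm : ¬ r m ≤ 1 / 2)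
    (i : ι) : mix r i - r i * coef r i = excess r * excess r *
      (if i = m then 1 else 1 / ((Fintype.card ι : ℝ) - 1)) := by
  have hE := hr.excess_eq hm
  by_cases hi : i = m
  · subst hi
    rw [mix, coef, if_neg hm, if_neg hm, if_pos rfl, show r i = excess r + 1 / 2 by linarith]
    ring
  · have := hr.le_half_of_ne hm hi
    rw [mix, coef, if_pos this, if_pos this, if_neg hi]
    ring

theorem mix_eq_of_le_half {r : ι → ℝ} (h : ∀ i, r i ≤ 1 / 2) (i : ι) : mix r i = r i := by
  rw [mix, if_pos (h i), excess_eq_zero h]; ring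

theorem coef_eq_of_le_half {r : ι → ℝ} (h : ∀ i, r i ≤ 1 / 2) (i : ι) : coef r i = 1 := by
  rw [coef, if_pos (h i), excess_eq_zero h]; ring

theorem sum_mul_ite [DecidableEq ι] (m : ι) (x : ℝ) (y : ι → ℝ) :
    ∑ i, (if i = m then 1 else x) * y i = y m + x * ∑ i ∈ Finset.univ.erase m, y i := by
  rw [← Finset.add_sum_erase _ _ (Finset.mem_univ m), if_pos rfl, one_mul, Finset.mul_sum]
  congr 1
  exact Finset.sum_congr rfl fun i hi => by rw [if_neg (Finset.ne_of_mem_erase hi)]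

theorem IsDist.sum_coef [DecidableEq ι] {r : ι → ℝ} (hr : IsDist r) {m : ι}
    (hm : ¬ r m ≤ 1 / 2) : ∑ i, r i * coef r i = 1 - 2 * (excess r * excess r) := by
  have h : ∀ i, r i * coef r i = r i * (1 + excess r) - (if i = m then r m * (2 * excess r) else 0) := by
    intro i
    by_cases hi : i = m
    · subst hi; rw [coef, if_neg hm, if_pos rfl]; ring
    · rw [coef, if_pos (hr.le_half_of_ne hm hi), if_neg hi]; ring
  simp only [h, Finset.sum_sub_distrib, ← Finset.sum_mul, hr.2, Finset.sum_ite_eq',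
    Finset.mem_univ, if_true]
  rw [show r m = excess r + 1 / 2 by linarith [hr.excess_eq hm]]
  ring

theorem IsDist.mix {r : ι → ℝ} (hr : IsDist r) (hc : 2 ≤ Fintype.card ι) : IsDist (mix r) := by
  classical
  have hE := excess_nonneg r
  have hc' : (2 : ℝ) ≤ Fintype.card ι := by exact_mod_cast hc
  refine ⟨fun i => ?_, ?_⟩
  · have := hr.1 i
    unfold OnlineKSubmod.mix
    split_ifs
    · have : 0 ≤ (Fintype.card ι : ℝ) - 1 := by linarith
      positivity
    · positivity
  by_cases h : ∀ i, r i ≤ 1 / 2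
  · simp only [mix_eq_of_le_half h, hr.2]
  · obtain ⟨m, hm⟩ := not_forall.mp h
    have h1 : ∑ i, (OnlineKSubmod.mix r i - r i * coef r i) = 2 * (excess r * excess r) := by
      have := sum_mul_ite m (1 / ((Fintype.card ι : ℝ) - 1)) fun _ => (1 : ℝ)
      simp only [mul_one, Finset.sum_const, Finset.card_erase_of_mem (Finset.mem_univ m),
        Finset.card_univ, nsmul_eq_mul] at this
      simp only [hr.mix_sub hm, ← Finset.mul_sum]
      rw [this, Nat.cast_sub (by omega), Nat.cast_one, one_div, inv_mul_cancel₀ (by linarith)]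
      ring
    rw [Finset.sum_sub_distrib, hr.sum_coef hm] at h1
    linarith

/-- Every entry bounds the average of a vector with nonnegative sums of pairs. -/
theorem PairNonneg.avg_ge [DecidableEq ι] {p a : ι → ℝ} (hp : IsDist p) (ha : PairNonneg a)
    (l : ι) : 0 ≤ ∑ i, p i * a i + (1 - 2 * p l) * a l := by
  have h1 : ∑ i ∈ Finset.univ.erase l, p i * (-a l) ≤ ∑ i ∈ Finset.univ.erase l, p i * a i :=
    Finset.sum_le_sum fun i hi =>
      mul_le_mul_of_nonneg_left (by linarith [ha i l (Finset.ne_of_mem_erase hi)]) (hp.1 i)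
  have h2 := Finset.add_sum_erase _ p (Finset.mem_univ l)
  have h3 := Finset.add_sum_erase _ (fun i => p i * a i) (Finset.mem_univ l)
  rw [hp.2] at h2
  rw [← Finset.sum_mul, show ∑ i ∈ Finset.univ.erase l, p i = 1 - p l by linarith] at h1
  linarith

/-- If some a_l ≤ 0, then all other entries are at least -a_l and carry at least half of the mass.
-/
theorem PairNonneg.avg_nonneg {p a : ι → ℝ} (hp : IsDist p) (ha : PairNonneg a)
    (h : ∀ i, p i ≤ 1 / 2) : 0 ≤ ∑ i, p i * a i := by
  classical
  by_cases hl : ∃ l, a l ≤ 0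
  · obtain ⟨l, hl⟩ := hl
    have := ha.avg_ge hp l
    nlinarith [h l]
  · push Not at hl
    exact Finset.sum_nonneg fun i _ => mul_nonneg (hp.1 i) (hl i).le

/-- The expected loss with respect to label `i` is bounded by the marginal gain of `i`. -/
theorem IsDist.sub_avg_le {r a y : ι → ℝ} (hr : IsDist r) (hc : 2 ≤ Fintype.card ι)
    (ha : PairNonneg a) (hay : ∀ i, a i ≤ y i) (i : ι) :
    a i - ∑ l, OnlineKSubmod.mix r l * a l ≤ coef r i * y i := by
  classical
  refine le_trans ?_ (mul_le_mul_of_nonneg_left (hay i) (hr.coef_mem i).1)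
  by_cases h : ∀ i, r i ≤ 1 / 2
  · have := ha.avg_nonneg (hr.mix hc) fun i => (mix_eq_of_le_half h i).le.trans (h i)
    rw [coef_eq_of_le_half h]
    linarith
  · obtain ⟨m, hm⟩ := not_forall.mp h
    -- Since the heavy label has probability (1 + E)/2, this says that the average is at least E
    -- a_m. That settles i = m with coefficient 1 - E; for i ≠ m, a_m ≥ -a_i gives 1 + E.
    have h1 := ha.avg_ge (hr.mix hc) m
    have h2 : OnlineKSubmod.mix r m = (1 + excess r) / 2 := by rw [OnlineKSubmod.mix, if_neg hm]
    rw [h2] at h1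
    by_cases hi : i = m
    · subst hi
      rw [coef, if_neg hm]
      linarith
    · rw [coef, if_pos (hr.le_half_of_ne hm hi)]
      nlinarith [ha i m hi, excess_nonneg r]

/-- The increment of the regret vector when the marginal gains are `y`. -/
def regretInc (r y : ι → ℝ) (i : ι) : ℝ := coef r i * y i - ∑ l, mix r l * y l

/-- Blackwell's condition. Without a heavy label both sides agree; with heavy label m the difference
is E²/(K - 1) times the sum of y_i + y_m over i ≠ m, and these pair sums are nonnegative. -/
theorem IsDist.sum_coef_mul_le {r y : ι → ℝ} (hr : IsDist r) (hc : 2 ≤ Fintype.card ι)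
    (hy : PairNonneg y) : ∑ i, r i * (coef r i * y i) ≤ ∑ i, OnlineKSubmod.mix r i * y i := by
  classical
  by_cases h : ∀ i, r i ≤ 1 / 2
  · simp [coef_eq_of_le_half h, mix_eq_of_le_half h]
  · obtain ⟨m, hm⟩ := not_forall.mp h
    have hc' : (0 : ℝ) < (Fintype.card ι : ℝ) - 1 := by
      have : (2 : ℝ) ≤ Fintype.card ι := by exact_mod_cast hc
      linarith
    have h2 := sum_mul_ite m (1 / ((Fintype.card ι : ℝ) - 1)) y
    have h3 : 0 ≤ ∑ i ∈ Finset.univ.erase m, (y i + y m) :=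
      Finset.sum_nonneg fun i hi => hy i m (Finset.ne_of_mem_erase hi)
    rw [Finset.sum_add_distrib, Finset.sum_const, Finset.card_erase_of_mem (Finset.mem_univ m),
      Finset.card_univ, nsmul_eq_mul, Nat.cast_sub (by omega), Nat.cast_one] at h3
    have h4 : 0 ≤ y m + 1 / ((Fintype.card ι : ℝ) - 1) * ∑ i ∈ Finset.univ.erase m, y i := by
      have := mul_nonneg (one_div_nonneg.mpr hc'.le) h3
      rw [mul_add, ← mul_assoc, one_div_mul_cancel hc'.ne', one_mul] at this
      linarith
    rw [← sub_nonneg, ← Finset.sum_sub_distrib]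
    have h5 : ∀ i, OnlineKSubmod.mix r i * y i - r i * (coef r i * y i) = excess r * excess r *
        ((if i = m then 1 else 1 / ((Fintype.card ι : ℝ) - 1)) * y i) := by
      intro i
      rw [← mul_assoc, ← sub_mul, hr.mix_sub hm, mul_assoc]
    simp only [h5, ← Finset.mul_sum]
    rw [h2]
    exact mul_nonneg (mul_self_nonneg _) h4

/-- The increment points away from the positive part of the regret vector. -/
theorem sum_pos_mul_regretInc_le {G y : ι → ℝ} (hc : 2 ≤ Fintype.card ι)
    (hy : PairNonneg y) : ∑ i, max (G i) 0 * regretInc (posDist G) y i ≤ 0 := by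
  have : Nonempty ι := Fintype.card_pos_iff.mp (by omega)
  have h0 : ∀ i ∈ Finset.univ, 0 ≤ max (G i) 0 := fun _ _ => le_max_right _ _
  by_cases h : ∑ l, max (G l) 0 ≤ 0
  · have := (Finset.sum_eq_zero_iff_of_nonneg h0).mp (le_antisymm h (Finset.sum_nonneg h0))
    rw [Finset.sum_eq_zero fun i hi => by rw [this i hi, zero_mul]]
  · have hr := posDist_isDist G
    have h1 := hr.sum_coef_mul_le hc hy
    have h2 : ∀ i, max (G i) 0 = (∑ l, max (G l) 0) * posDist G i := by
      intro i
      rw [posDist, if_neg h, mul_div_cancel₀ _ (not_le.mp h).ne']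
    have h3 : ∀ i, max (G i) 0 * regretInc (posDist G) y i = (∑ l, max (G l) 0) *
        (posDist G i * (coef (posDist G) i * y i)
          - posDist G i * ∑ l, mix (posDist G) l * y l) := by
      intro i
      rw [h2 i, regretInc]
      ring
    simp only [h3, ← Finset.mul_sum, Finset.sum_sub_distrib, ← Finset.sum_mul, hr.2]
    exact mul_nonpos_of_nonneg_of_nonpos (not_le.mp h).le (by linarith)

theorem IsDist.abs_regretInc_le {r y : ι → ℝ} (hr : IsDist r) (hc : 2 ≤ Fintype.card ι)
    (hy : ∀ i, |y i| ≤ 1) (i : ι) : |regretInc r y i| ≤ 3 := by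
  have h1 : |coef r i * y i| ≤ 2 := by
    rw [abs_mul, abs_of_nonneg (hr.coef_mem i).1]
    nlinarith [hr.coef_mem i, hy i, abs_nonneg (y i)]
  have h2 : |∑ l, OnlineKSubmod.mix r l * y l| ≤ 1 := by
    rw [← (hr.mix hc).2]
    refine (Finset.abs_sum_le_sum_abs _ _).trans (Finset.sum_le_sum fun l _ => ?_)
    rw [abs_mul, abs_of_nonneg ((hr.mix hc).1 l)]
    exact mul_le_of_le_one_right ((hr.mix hc).1 l) (hy l)
  unfold regretInc
  exact (abs_sub _ _).trans (by linarith)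

end Row

/-! ### Expectations on finite types -/

section Expectation

variable {α β : Type*} [Fintype α] [Fintype β]

/-- The expectation of a real function under a law on a finite type. -/
def expect (μ : PMF α) (φ : α → ℝ) : ℝ := ∑ a, (μ a).toReal * φ a

theorem sum_toReal_eq_one (μ : PMF α) : ∑ a, (μ a).toReal = 1 := by
  have h := μ.tsum_coe
  rw [tsum_fintype] at h
  rw [← ENNReal.toReal_sum fun a _ => μ.apply_ne_top a, h, ENNReal.toReal_one]

theorem expect_const (μ : PMF α) (c : ℝ) : expect μ (fun _ => c) = c := by
  rw [expect, ← Finset.sum_mul, sum_toReal_eq_one, one_mul]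

theorem expect_add (μ : PMF α) (φ ψ : α → ℝ) :
    expect μ (fun a => φ a + ψ a) = expect μ φ + expect μ ψ := by
  simp only [expect, mul_add, Finset.sum_add_distrib]

theorem expect_sub (μ : PMF α) (φ ψ : α → ℝ) :
    expect μ (fun a => φ a - ψ a) = expect μ φ - expect μ ψ := by
  simp only [expect, mul_sub, Finset.sum_sub_distrib]

theorem expect_const_mul (μ : PMF α) (c : ℝ) (φ : α → ℝ) :
    expect μ (fun a => c * φ a) = c * expect μ φ := by
  simp only [expect, Finset.mul_sum]
  exact Finset.sum_congr rfl fun a _ => by ring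

theorem expect_sum {κ : Type*} (s : Finset κ) (μ : PMF α) (φ : κ → α → ℝ) :
    expect μ (fun a => ∑ i ∈ s, φ i a) = ∑ i ∈ s, expect μ (φ i) := by
  simp only [expect, Finset.mul_sum]
  exact Finset.sum_comm

theorem expect_mono {μ : PMF α} {φ ψ : α → ℝ} (h : ∀ a ∈ μ.support, φ a ≤ ψ a) :
    expect μ φ ≤ expect μ ψ := by
  refine Finset.sum_le_sum fun a _ => ?_
  by_cases ha : a ∈ μ.support
  · exact mul_le_mul_of_nonneg_left (h a ha) ENNReal.toReal_nonneg
  · rw [(PMF.apply_eq_zero_iff μ a).mpr ha]; simp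

theorem expect_pure [DecidableEq α] (a : α) (φ : α → ℝ) : expect (PMF.pure a) φ = φ a := by
  rw [expect, Finset.sum_eq_single a]
  · simp
  · intro b _ hb; simp [hb]
  · simp

theorem expect_bind (μ : PMF α) (ν : α → PMF β) (φ : β → ℝ) :
    expect (μ.bind ν) φ = expect μ fun a => expect (ν a) φ := by
  have h : ∀ b, ((μ.bind ν) b).toReal = ∑ a, (μ a).toReal * (ν a b).toReal := by
    intro b
    rw [PMF.bind_apply, tsum_fintype, ENNReal.toReal_sum fun a _ =>
      ENNReal.mul_ne_top (μ.apply_ne_top a) ((ν a).apply_ne_top b)]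
    simp only [ENNReal.toReal_mul]
  simp only [expect, h, Finset.sum_mul, Finset.mul_sum]
  rw [Finset.sum_comm]
  exact Finset.sum_congr rfl fun a _ => Finset.sum_congr rfl fun b _ => by ring

theorem expect_map (μ : PMF α) (g : α → β) (φ : β → ℝ) :
    expect (μ.map g) φ = expect μ (φ ∘ g) := by
  classical
  rw [← PMF.bind_pure_comp, expect_bind]
  simp only [Function.comp_apply, expect_pure]
  rfl

/-- The cross term vanishes because the increment is centered, and a variance is at most the second
moment. This is the one-step estimate for the martingale H - G. -/
theorem expect_sq_sub_le (μ : PMF α) (φ : α → ℝ) (D B : ℝ) (hB : ∀ a, |φ a| ≤ B) :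
    expect μ (fun a => (D + (expect μ φ - φ a)) ^ 2) ≤ D ^ 2 + B ^ 2 := by
  have h : ∀ a, (D + (expect μ φ - φ a)) ^ 2
      = ((D + expect μ φ) ^ 2 - 2 * (D + expect μ φ) * φ a) + φ a ^ 2 := fun a => by ring
  have h2 : expect μ (fun a => φ a ^ 2) ≤ B ^ 2 := by
    rw [← expect_const μ (B ^ 2)]
    exact expect_mono fun a _ => sq_le_sq' (abs_le.mp (hB a)).1 (abs_le.mp (hB a)).2
  simp only [h]
  rw [expect_add, expect_sub, expect_const, expect_const_mul]
  nlinarith [sq_nonneg (expect μ φ)]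

end Expectation

/-! ### Partial labelings -/

section Splice

variable {ι : Type*} {n : ℕ}

/-- The first `m` coordinates of `ξ`, completed by `o`. -/
def splice {α : Type*} (m : ℕ) (ξ o : Fin n → α) (l : Fin n) : α := if (l : ℕ) < m then ξ l else o l

/-- The marginal gains of the labels of coordinate `j` after the first `j` coordinates of `ξ`. -/
def gain (F : (Fin n → Option ι) → ℝ) (ξ : Fin n → Option ι) (j : Fin n) (i : ι) : ℝ :=
  F (Function.update (splice j ξ fun _ => none) j (some i)) - F (splice j ξ fun _ => none)

theorem splice_splice_none {m : ℕ} (hm : m < n) {ξ : Fin n → Option ι}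
    (hξ : ∀ l : Fin n, (ξ l).isSome ↔ (l : ℕ) < m) (i : Option ι) :
    splice m (Function.update ξ ⟨m, hm⟩ i) (fun _ => none) = ξ := by
  funext l
  by_cases hl : (l : ℕ) < m
  · rw [splice, if_pos hl, Function.update_of_ne fun h => hl.ne (Fin.ext_iff.mp h)]
  · rw [splice, if_neg hl]
    exact (Option.not_isSome_iff_eq_none.mp ((hξ l).not.mpr hl)).symm

/-- The gains at j look only at the labels before j, so later samples do not alter them. -/
theorem gain_update {F : (Fin n → Option ι) → ℝ} {ξ : Fin n → Option ι} {m : ℕ} (hm : m < n)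
    {j : Fin n} (hj : (j : ℕ) < m) (i : Option ι) :
    gain F (Function.update ξ ⟨m, hm⟩ i) j = gain F ξ j := by
  have : splice j (Function.update ξ ⟨m, hm⟩ i) (fun _ => none) = splice j ξ fun _ => none := by
    funext l
    unfold splice
    split_ifs with hl
    · rw [Function.update_of_ne]
      intro h
      have := Fin.ext_iff.mp h
      simp only at this
      omega
    · rfl
  funext l
  rw [gain, gain, this]

/-- The value c is overwritten; it is there so that the hybrid with coordinate m erased (c = `none`)
can serve as the common base point. -/
theorem splice_succ_update {α : Type*} {m : ℕ} (hm : m < n) (ξ o : Fin n → α) (i c : α) :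
    splice (m + 1) (Function.update ξ ⟨m, hm⟩ i) o
      = Function.update (Function.update (splice m ξ o) ⟨m, hm⟩ c) ⟨m, hm⟩ i := by
  funext l
  by_cases hl : l = ⟨m, hm⟩
  · subst hl; simp [splice]
  · have : (l : ℕ) ≠ m := fun h => hl (Fin.ext h)
    have h2 : (l : ℕ) < m + 1 ↔ (l : ℕ) < m := by omega
    simp only [splice, Function.update_of_ne hl, h2]

end Splice

/-! ### Sampling the coordinates one after the other -/

section Round

variable {ι : Type*} [Fintype ι] {n : ℕ}

/-- The law of a random label. -/
def labelLaw (p : ι → ℝ) (hp : IsDist p) : PMF ι :=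
  PMF.ofFintype (fun i => ENNReal.ofReal (p i)) (by
    rw [← ENNReal.ofReal_sum_of_nonneg fun i _ => hp.1 i, hp.2, ENNReal.ofReal_one])

theorem expect_labelLaw {p : ι → ℝ} (hp : IsDist p) (φ : ι → ℝ) :
    expect (labelLaw p hp) φ = ∑ i, p i * φ i := by
  refine Finset.sum_congr rfl fun i _ => ?_
  rw [labelLaw, PMF.ofFintype_apply, ENNReal.toReal_ofReal (hp.1 i)]

/-- The law of the partial labeling after the first `m` coordinates have been labeled. -/
def seqLaw (p : Fin n → ι → ℝ) (hp : ∀ j, IsDist (p j)) : ℕ → PMF (Fin n → Option ι)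
  | 0 => PMF.pure fun _ => none
  | m + 1 => (seqLaw p hp m).bind fun ξ =>
      if h : m < n then
        (labelLaw (p ⟨m, h⟩) (hp ⟨m, h⟩)).map fun i => Function.update ξ ⟨m, h⟩ (some i)
      else PMF.pure ξ

theorem seqLaw_succ (p : Fin n → ι → ℝ) (hp : ∀ j, IsDist (p j)) {m : ℕ} (h : m < n) :
    seqLaw p hp (m + 1) = (seqLaw p hp m).bind fun ξ =>
      (labelLaw (p ⟨m, h⟩) (hp ⟨m, h⟩)).map fun i => Function.update ξ ⟨m, h⟩ (some i) := by
  simp only [seqLaw, dif_pos h]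

theorem isSome_of_mem_support_seqLaw {p : Fin n → ι → ℝ} {hp : ∀ j, IsDist (p j)} {m : ℕ}
    (hm : m ≤ n) {ξ : Fin n → Option ι} (hξ : ξ ∈ (seqLaw p hp m).support) (l : Fin n) :
    (ξ l).isSome ↔ (l : ℕ) < m := by
  induction m generalizing ξ with
  | zero =>
    rw [seqLaw, PMF.support_pure, Set.mem_singleton_iff] at hξ
    simp [hξ]
  | succ m ih =>
    rw [seqLaw_succ p hp hm, PMF.mem_support_bind_iff] at hξ
    obtain ⟨ζ, hζ, hξ⟩ := hξ
    obtain ⟨i, -, rfl⟩ := (PMF.mem_support_map_iff _ _ _).mp hξ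
    by_cases hl : l = ⟨m, hm⟩
    · subst hl; simp
    · rw [Function.update_of_ne hl, ih (by omega) hζ]
      have : (l : ℕ) ≠ m := fun h => hl (Fin.ext h)
      omega

/-- The properties of `k`-submodular functions that the analysis uses. -/
structure Orthant (F : (Fin n → Option ι) → ℝ) : Prop where
  pair : ∀ ξ j, ξ j = none →
    PairNonneg fun i => F (Function.update ξ j (some i)) - F ξ
  orth : ∀ ξ ζ j, (∀ l, ξ l = none ∨ ξ l = ζ l) → ζ j = none → ∀ i,
    F (Function.update ζ j (some i)) - F ζ ≤ F (Function.update ξ j (some i)) - F ξ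

/-- The value of a label, or the average of two labels for `none`. -/
def labelVal (i₀ i₁ : ι) (v : ι → ℝ) : Option ι → ℝ
  | none => (v i₀ + v i₁) / 2
  | some i => v i

/-- One coordinate of the telescoping: the hybrid's loss minus the play's gain is at most the regret
increment. For `none`, the inequalities of the two labels are averaged. -/
theorem labelVal_sub_avg_le {r a y : ι → ℝ} {i₀ i₁ : ι} (hi : i₀ ≠ i₁) (hr : IsDist r)
    (ha : PairNonneg a) (hay : ∀ i, a i ≤ y i) (o : Option ι) :
    labelVal i₀ i₁ a o - ∑ l, mix r l * a l - ∑ l, mix r l * y l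
      ≤ labelVal i₀ i₁ (regretInc r y) o := by
  have hc : 2 ≤ Fintype.card ι :=
    Nat.succ_le_of_lt (Fintype.one_lt_card_iff.mpr ⟨i₀, i₁, hi⟩)
  have h := hr.sub_avg_le hc ha hay
  cases o with
  | none =>
    have h0 := h i₀
    have h1 := h i₁
    simp only [labelVal, regretInc]
    linarith
  | some i =>
    have h0 := h i
    simp only [labelVal, regretInc]
    linarith

theorem expect_seqLaw_step {p : Fin n → ι → ℝ} {hp : ∀ j, IsDist (p j)} {m : ℕ} (hm : m < n)
    (φ : (Fin n → Option ι) → ℝ) :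
    expect (seqLaw p hp (m + 1)) φ = expect (seqLaw p hp m) fun ξ =>
      ∑ i, p ⟨m, hm⟩ i * φ (Function.update ξ ⟨m, hm⟩ (some i)) := by
  rw [seqLaw_succ p hp hm, expect_bind]
  congr 1
  funext ξ
  rw [expect_map, expect_labelLaw]
  rfl

/-- The analysis of a single round, up to coordinate `m`. -/
theorem expect_seqLaw_le {F : (Fin n → Option ι) → ℝ} (hF : Orthant F) {i₀ i₁ : ι} (hi : i₀ ≠ i₁)
    {r : Fin n → ι → ℝ} (hr : ∀ j, IsDist (r j)) (hp : ∀ j, IsDist (mix (r j)))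
    (o : Fin n → Option ι) {m : ℕ} (hm : m ≤ n) :
    F o + F (fun _ => none) ≤ expect (seqLaw (fun j => mix (r j)) hp m) fun ξ =>
      F (splice m ξ o) + F ξ + ∑ j : Fin n,
        if (j : ℕ) < m then labelVal i₀ i₁ (regretInc (r j) (gain F ξ j)) (o j) else 0 := by
  classical
  induction m with
  | zero =>
    have h0 : splice 0 (fun _ => none) o = o := by
      funext l; simp [splice]
    rw [seqLaw, expect_pure, h0]
    simp
  | succ m ih =>
    refine (ih (by omega)).trans ?_
    rw [expect_seqLaw_step hm]
    refine expect_mono fun ξ hξ => ?_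
    have hs := isSome_of_mem_support_seqLaw (by omega) hξ
    have hnone : ξ ⟨m, hm⟩ = none := by
      rw [← Option.not_isSome_iff_eq_none, hs]; simp
    -- The old and the new hybrid both arise from z by setting coordinate m: the old one to the
    -- entry of o, the new one to the sampled label.
    set z := Function.update (splice m ξ o) ⟨m, hm⟩ none with hz
    set p := mix (r ⟨m, hm⟩)
    set y := fun i => F (Function.update ξ ⟨m, hm⟩ (some i)) - F ξ with hy
    set a := fun i => F (Function.update z ⟨m, hm⟩ (some i)) - F z with ha
    have hzm : z ⟨m, hm⟩ = none := by simp [hz]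
    have hgain : ∀ i, gain F (Function.update ξ ⟨m, hm⟩ (some i)) ⟨m, hm⟩ = y := by
      intro i
      funext l
      rw [gain, splice_splice_none hm hs]
    have hap : PairNonneg a := hF.pair z _ hzm
    -- The prefix ξ lies below z: they agree before m, and ξ is unlabeled from m on.
    have hay : ∀ i, a i ≤ y i := by
      refine hF.orth ξ z _ (fun l => ?_) hzm
      by_cases hl : (l : ℕ) < m
      · right
        rw [hz, Function.update_of_ne fun h => hl.ne (Fin.ext_iff.mp h), splice, if_pos hl]
      · left
        rw [← Option.not_isSome_iff_eq_none, hs]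
        exact hl
    have key := labelVal_sub_avg_le hi (hr ⟨m, hm⟩) hap hay (o ⟨m, hm⟩)
    -- If o is unlabeled at m, the left side is 0, and the average of two gains is nonnegative by
    -- pairwise nonnegativity.
    have hoz : F (splice m ξ o) - F z ≤ labelVal i₀ i₁ a (o ⟨m, hm⟩) := by
      have h1 : splice m ξ o = Function.update z ⟨m, hm⟩ (o ⟨m, hm⟩) := by
        rw [hz, Function.update_idem]
        symm
        rw [Function.update_eq_self_iff]
        simp [splice]
      rw [h1]
      cases o ⟨m, hm⟩ with
      | none =>
        rw [← hzm, Function.update_eq_self, sub_self]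
        rw [hzm, labelVal]
        linarith [hap i₀ i₁ hi]
      | some i => exact le_rfl
    have hsum : ∀ i, (∑ j : Fin n, if (j : ℕ) < m + 1 then
          labelVal i₀ i₁ (regretInc (r j) (gain F (Function.update ξ ⟨m, hm⟩ (some i)) j)) (o j)
          else 0)
        = (∑ j : Fin n, if (j : ℕ) < m then
            labelVal i₀ i₁ (regretInc (r j) (gain F ξ j)) (o j) else 0)
          + labelVal i₀ i₁ (regretInc (r ⟨m, hm⟩) y) (o ⟨m, hm⟩) := by
      intro i
      rw [← Finset.sum_erase_add _ _ (Finset.mem_univ (⟨m, hm⟩ : Fin n)),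
        ← Finset.sum_erase_add (a := (⟨m, hm⟩ : Fin n)) (f := fun j : Fin n =>
          if (j : ℕ) < m then _ else _) _ (Finset.mem_univ _)]
      simp only [hgain, lt_irrefl, if_false, add_zero, Nat.lt_succ_self, if_true]
      congr 1
      refine Finset.sum_congr rfl fun j hj => ?_
      have : (j : ℕ) ≠ m := fun h => Finset.ne_of_mem_erase hj (Fin.ext h)
      by_cases hjm : (j : ℕ) < m
      · rw [if_pos hjm, if_pos (by omega), gain_update hm hjm]
      · rw [if_neg hjm, if_neg (by omega)]
    have hFz : ∀ i, F (splice (m + 1) (Function.update ξ ⟨m, hm⟩ (some i)) o) = a i + F z := by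
      intro i
      rw [splice_succ_update hm ξ o (some i) none, ha]
      ring
    have hFy : ∀ i, F (Function.update ξ ⟨m, hm⟩ (some i)) = y i + F ξ := by
      intro i; rw [hy]; ring
    simp only [hsum, hFz, hFy]
    have hp1 : ∑ i, p i = 1 := (hp ⟨m, hm⟩).2
    simp only [mul_add, Finset.sum_add_distrib, ← Finset.sum_mul, hp1]
    linarith

/-- The analysis of a single round. -/
theorem le_two_mul_expect_seqLaw {F : (Fin n → Option ι) → ℝ} (hF : Orthant F) {i₀ i₁ : ι}
    (hi : i₀ ≠ i₁) {r : Fin n → ι → ℝ} (hr : ∀ j, IsDist (r j))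
    (hp : ∀ j, IsDist (mix (r j))) (o : Fin n → Option ι) (h0 : 0 ≤ F fun _ => none) :
    F o - 2 * expect (seqLaw (fun j => mix (r j)) hp n) F ≤
      ∑ j : Fin n, labelVal i₀ i₁ (fun i =>
        expect (seqLaw (fun j => mix (r j)) hp n) fun ξ => regretInc (r j) (gain F ξ j) i) (o j) := by
  have h := expect_seqLaw_le hF hi hr hp o le_rfl
  have h1 : ∀ ξ : Fin n → Option ι, splice n ξ o = ξ := fun ξ => by
    funext l; simp [splice]
  simp only [h1, Fin.is_lt, if_true] at h
  rw [expect_add, expect_add, expect_sum] at h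
  have h2 : ∀ j, expect (seqLaw (fun j => mix (r j)) hp n)
      (fun ξ => labelVal i₀ i₁ (regretInc (r j) (gain F ξ j)) (o j)) = labelVal i₀ i₁ (fun i =>
        expect (seqLaw (fun j => mix (r j)) hp n) fun ξ => regretInc (r j) (gain F ξ j) i)
        (o j) := by
    intro j
    cases o j with
    | none =>
      simp only [labelVal, div_eq_inv_mul]
      rw [expect_const_mul, expect_add]
    | some i => rfl
  simp only [h2] at h
  linarith

end Round

/-! ### `k`-submodular functions and labels

For `k ≥ 2` the labels are the nonzero elements of `{0, …, k}`, and unlabeled coordinates are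
filled up with `0`. For `k = 1` the two labels are the elements `1` and `0`, the gain of the first
one being measured with unlabeled coordinates `0` and that of the second one with unlabeled
coordinates `1`. -/

section Labels

variable {n k : ℕ}

/-- The number of labels, which is `max k 2`. -/
abbrev numLabels (k : ℕ) : ℕ := k + (2 - k)

theorem two_le_numLabels : 2 ≤ numLabels k := by unfold numLabels; omega

/-- Cut off a natural number to `{0, …, k}`. -/
def clip (k v : ℕ) : Fin (k + 1) := ⟨min v k, Nat.lt_succ_of_le (min_le_right _ _)⟩

/-- The value of the unlabeled coordinates for the label with index `i`. -/
def lowNat (k i : ℕ) : ℕ := i + 1 - k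

/-- The value of the label with index `i`. -/
def highNat (k i : ℕ) : ℕ := i + 1 - lowNat k i - lowNat k i

/-- The value of the unlabeled coordinates for a label. -/
def low (i : Fin (numLabels k)) : Fin (k + 1) := clip k (lowNat k i)

/-- The value of a label. -/
def high (i : Fin (numLabels k)) : Fin (k + 1) := clip k (highNat k i)

/-- The two labels used for averaging. -/
def lab₀ : Fin (numLabels k) := ⟨0, lt_of_lt_of_le Nat.zero_lt_two two_le_numLabels⟩

/-- The two labels used for averaging. -/
def lab₁ : Fin (numLabels k) := ⟨1, lt_of_lt_of_le Nat.one_lt_two two_le_numLabels⟩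

theorem lab₀_ne_lab₁ : (lab₀ : Fin (numLabels k)) ≠ lab₁ := by
  simp [lab₀, lab₁]

/-- The vector of a partial labeling, with `d` in the unlabeled coordinates. -/
def fill (d : Fin (k + 1)) (ξ : Fin n → Option (Fin (numLabels k))) : Vec n k :=
  fun l => (ξ l).elim d high

/-- The function on partial labelings induced by a function on `{0, …, k}^V`. -/
def lift (f : Vec n k → ℝ) (ξ : Fin n → Option (Fin (numLabels k))) : ℝ :=
  if k = 1 then f (fill 0 ξ) + f (fill 1 ξ) else f (fill 0 ξ)

/-- The factor between a function and the induced function on labelings. -/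
def liftFactor (k : ℕ) : ℝ := if k = 1 then 2 else 1

/-- The marginal gain of label `i` at coordinate `j` after the first `j` coordinates of `x`. -/
def marg (f : Vec n k → ℝ) (x : Vec n k) (j : Fin n) (i : Fin (numLabels k)) : ℝ :=
  f (Function.update (splice j x fun _ => low i) j (high i)) - f (splice j x fun _ => low i)

theorem fill_update (d : Fin (k + 1)) (ξ : Fin n → Option (Fin (numLabels k))) (j : Fin n)
    (i : Fin (numLabels k)) :
    fill d (Function.update ξ j (some i)) = Function.update (fill d ξ) j (high i) := by
  funext l
  by_cases h : l = j
  · subst h; simp [fill]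
  · simp [fill, Function.update_of_ne h]

theorem low_eq_zero (hk : 2 ≤ k) (i : Fin (numLabels k)) : low i = 0 := by
  have := i.is_lt
  ext
  simp only [low, clip, lowNat, Fin.val_zero]
  unfold numLabels at *
  omega

theorem val_high (hk : 2 ≤ k) (i : Fin (numLabels k)) : (high i : ℕ) = i + 1 := by
  have := i.is_lt
  simp only [high, clip, lowNat, highNat]
  unfold numLabels at *
  omega

theorem high_ne_zero (hk : 2 ≤ k) (i : Fin (numLabels k)) : high i ≠ 0 := by
  intro h
  have := val_high hk i
  rw [h] at this
  simp at this

theorem high_injective (hk : 2 ≤ k) : Function.Injective (high : Fin (numLabels k) → _) := by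
  intro i l h
  have h1 := val_high hk i
  have h2 := val_high hk l
  rw [h] at h1
  ext
  omega

/-! ### Pairwise nonnegativity and diminishing gains from `k`-submodularity -/

theorem cup_of_le {a b : Fin (k + 1)} (h : a = 0 ∨ a = b) : cup a b = b := by
  rcases h with rfl | rfl
  · simp [cup]
  · simp [cup]

theorem cap_of_le {a b : Fin (k + 1)} (h : a = 0 ∨ a = b) : cap a b = a := by
  rcases h with rfl | rfl
  · simp [cap]
  · simp [cap]

theorem cup_comm (a b : Fin (k + 1)) : cup a b = cup b a := by
  unfold cup
  rw [max_comm]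
  congr 1
  exact propext ⟨by tauto, by tauto⟩

theorem cap_comm (a b : Fin (k + 1)) : cap a b = cap b a := by
  unfold cap
  rw [min_comm]
  congr 1
  exact propext ⟨by tauto, by tauto⟩

theorem cup_of_ne {a b : Fin (k + 1)} (ha : a ≠ 0) (hb : b ≠ 0) (h : a ≠ b) : cup a b = 0 := by
  simp [cup, ha, hb, h]

theorem cap_of_ne {a b : Fin (k + 1)} (ha : a ≠ 0) (hb : b ≠ 0) (h : a ≠ b) : cap a b = 0 := by
  simp [cap, ha, hb, h]

/-- Two different nonzero values at j cancel to 0 under both operations, so the join and the meet of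
the two modified points are both x. -/
theorem KSubmodular.pair {f : Vec n k → ℝ} (hf : KSubmodular f) {x : Vec n k} {j : Fin n}
    (hx : x j = 0) {a b : Fin (k + 1)} (ha : a ≠ 0) (hb : b ≠ 0) (h : a ≠ b) :
    0 ≤ f (Function.update x j a) - f x + (f (Function.update x j b) - f x) := by
  have key := hf (Function.update x j a) (Function.update x j b)
  have h1 : (fun l => cup (Function.update x j a l) (Function.update x j b l)) = x := by
    funext l
    by_cases hl : l = j
    · subst hl; simp [cup_of_ne ha hb h, hx]
    · simp [Function.update_of_ne hl, cup_of_le]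
  have h2 : (fun l => cap (Function.update x j a l) (Function.update x j b l)) = x := by
    funext l
    by_cases hl : l = j
    · subst hl; simp [cap_of_ne ha hb h, hx]
    · simp [Function.update_of_ne hl, cap_of_le]
  rw [h1, h2] at key
  linarith

/-- With x below z, the join of the modified x with z is the modified z, and their meet is x. -/
theorem KSubmodular.orth {f : Vec n k → ℝ} (hf : KSubmodular f) {x z : Vec n k} {j : Fin n}
    (hxz : ∀ l, x l = 0 ∨ x l = z l) (hz : z j = 0) (a : Fin (k + 1)) :
    f (Function.update z j a) - f z ≤ f (Function.update x j a) - f x := by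
  have hx : x j = 0 := by rcases hxz j with h | h <;> simp [h, hz]
  have key := hf (Function.update x j a) z
  have h1 : (fun l => cup (Function.update x j a l) (z l)) = Function.update z j a := by
    funext l
    by_cases hl : l = j
    · subst hl
      simp only [Function.update_self, hz]
      rw [cup_comm, cup_of_le (Or.inl rfl)]
    · simp only [Function.update_of_ne hl]
      exact cup_of_le (hxz l)
  have h2 : (fun l => cap (Function.update x j a l) (z l)) = x := by
    funext l
    by_cases hl : l = j
    · subst hl
      simp only [Function.update_self, hz, hx]
      rw [cap_comm, cap_of_le (Or.inl rfl)]
    · simp only [Function.update_of_ne hl]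
      exact cap_of_le (hxz l)
  rw [h1, h2] at key
  linarith

/-! ### The induced function on labelings; for `k = 1`, double greedy -/

theorem eq_lab (i : Fin (numLabels 1)) : i = lab₀ ∨ i = lab₁ := by
  have := i.is_lt
  simp only [lab₀, lab₁, Fin.ext_iff]
  unfold numLabels at *
  omega

theorem high_lab₀ : high (lab₀ : Fin (numLabels 1)) = 1 := rfl

theorem high_lab₁ : high (lab₁ : Fin (numLabels 1)) = 0 := rfl

theorem low_lab₀ : low (lab₀ : Fin (numLabels 1)) = 0 := rfl

theorem low_lab₁ : low (lab₁ : Fin (numLabels 1)) = 1 := rfl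

theorem eq_zero_or_one (a : Fin (1 + 1)) : a = 0 ∨ a = 1 := by
  fin_cases a <;> simp

/-- A label changes only one of the two completions: `lab₀` inserts j into the lower set, `lab₁`
deletes j from the upper set. Submodularity between these nested sets gives the pair inequality.
Labeling more coordinates enlarges the lower set and shrinks the upper one, so both gains decrease.
-/
theorem orthant_lift_one {f : Vec n 1 → ℝ} (hf : KSubmodular f) : Orthant (lift f) := by
  have h0 : ∀ (ξ : Fin n → Option (Fin (numLabels 1))) j, ξ j = none →
      lift f (Function.update ξ j (some lab₀)) - lift f ξ
        = f (Function.update (fill 0 ξ) j 1) - f (fill 0 ξ) := by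
    intro ξ j hj
    have : Function.update (fill 1 ξ) j 1 = fill 1 ξ := by simp [fill, hj]
    simp only [lift, if_true, fill_update, high_lab₀, this]
    ring
  have h1 : ∀ (ξ : Fin n → Option (Fin (numLabels 1))) j, ξ j = none →
      lift f (Function.update ξ j (some lab₁)) - lift f ξ
        = f (Function.update (fill 1 ξ) j 0) - f (fill 1 ξ) := by
    intro ξ j hj
    have : Function.update (fill 0 ξ) j 0 = fill 0 ξ := by simp [fill, hj]
    simp only [lift, if_true, fill_update, high_lab₁, this]
    ring
  have hle : ∀ (ξ : Fin n → Option (Fin (numLabels 1))) l, fill 0 ξ l = 0 ∨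
      fill 0 ξ l = fill 1 ξ l := by
    intro ξ l
    unfold fill
    cases ξ l <;> simp
  have hpair : ∀ (ξ : Fin n → Option (Fin (numLabels 1))) j, ξ j = none →
      0 ≤ f (Function.update (fill 0 ξ) j 1) - f (fill 0 ξ)
        + (f (Function.update (fill 1 ξ) j 0) - f (fill 1 ξ)) := by
    intro ξ j hj
    -- Inserting j gains at least as much in the lower set as in the upper set without j, and the
    -- latter gain is minus the gain of the deletion.
    have hz : Function.update (fill 1 ξ) j 0 j = 0 := Function.update_self ..
    have := hf.orth (x := fill 0 ξ) (z := Function.update (fill 1 ξ) j 0) (j := j) (fun l => by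
      by_cases hl : l = j
      · subst hl; simp [fill, hj]
      · rw [Function.update_of_ne hl]; exact hle ξ l) hz 1
    rw [Function.update_idem, show Function.update (fill 1 ξ) j 1 = fill 1 ξ by
      simp [fill, hj]] at this
    linarith
  refine ⟨fun ξ j hj i l hil => ?_, fun ξ ζ j hξζ hj i => ?_⟩
  · rcases eq_lab i with rfl | rfl <;> rcases eq_lab l with rfl | rfl
    · exact absurd rfl hil
    · simp only [h0 ξ j hj, h1 ξ j hj]; exact hpair ξ j hj
    · simp only [h0 ξ j hj, h1 ξ j hj]; linarith [hpair ξ j hj]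
    · exact absurd rfl hil
  · have hξ : ξ j = none := by rcases hξζ j with h | h <;> simp [h, hj]
    rcases eq_lab i with rfl | rfl
    · rw [h0 ξ j hξ, h0 ζ j hj]
      refine hf.orth (fun l => ?_) (by simp [fill, hj]) 1
      rcases hξζ l with h | h
      · left; simp [fill, h]
      · right; simp [fill, h]
    · rw [h1 ξ j hξ, h1 ζ j hj]
      -- The roles are swapped: the upper completion of the larger labeling ζ is the smaller set.
      have := hf.orth (x := Function.update (fill 1 ζ) j 0) (z := Function.update (fill 1 ξ) j 0)
        (j := j) (fun l => by
          by_cases hl : l = j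
          · subst hl; simp
          · simp only [Function.update_of_ne hl]
            rcases hξζ l with h | h
            · have : fill 1 ξ l = 1 := by simp [fill, h]
              rw [this]
              exact eq_zero_or_one _
            · right; simp [fill, h]) (Function.update_self ..) 1
      rw [Function.update_idem, Function.update_idem,
        show Function.update (fill 1 ξ) j 1 = fill 1 ξ by simp [fill, hξ],
        show Function.update (fill 1 ζ) j 1 = fill 1 ζ by simp [fill, hj]] at this
      linarith

theorem orthant_lift (hk : 1 ≤ k) {f : Vec n k → ℝ} (hf : KSubmodular f) : Orthant (lift f) := by
  rcases hk.eq_or_lt with rfl | hk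
  · exact orthant_lift_one hf
  have hl : ∀ ξ, lift f ξ = f (fill 0 ξ) := fun ξ => by rw [lift, if_neg (by omega)]
  refine ⟨fun ξ j hj i l hil => ?_, fun ξ ζ j hξζ hj i => ?_⟩
  · simp only [hl, fill_update]
    exact hf.pair (by simp [fill, hj]) (high_ne_zero hk i) (high_ne_zero hk l)
      fun h => hil (high_injective hk h)
  · simp only [hl, fill_update]
    refine hf.orth (fun l => ?_) (by simp [fill, hj]) _
    rcases hξζ l with h | h
    · left; simp [fill, h]
    · right; simp [fill, h]

theorem fill_eq_of_isSome {ξ : Fin n → Option (Fin (numLabels k))} (hξ : ∀ l, (ξ l).isSome)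
    (d : Fin (k + 1)) : fill d ξ = fill 0 ξ := by
  funext l
  obtain ⟨i, hi⟩ := Option.isSome_iff_exists.mp (hξ l)
  simp [fill, hi]

theorem lift_eq_of_isSome (f : Vec n k → ℝ) {ξ : Fin n → Option (Fin (numLabels k))}
    (hξ : ∀ l, (ξ l).isSome) : lift f ξ = liftFactor k * f (fill 0 ξ) := by
  rw [lift, liftFactor, fill_eq_of_isSome hξ 1]
  split_ifs <;> ring

theorem fill_splice {ξ : Fin n → Option (Fin (numLabels k))} (hξ : ∀ l, (ξ l).isSome)
    (d : Fin (k + 1)) (m : ℕ) :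
    fill d (splice m ξ fun _ => none) = splice m (fill 0 ξ) fun _ => d := by
  funext l
  rw [← fill_eq_of_isSome hξ d]
  by_cases hl : (l : ℕ) < m <;> simp [splice, fill, hl]

/-- For k = 1 the completion already holding the label's value contributes nothing. Hence two oracle
calls per coordinate and label suffice for every k, and the play alone determines the gains. -/
theorem gain_lift (hk : 1 ≤ k) (f : Vec n k → ℝ) {ξ : Fin n → Option (Fin (numLabels k))}
    (hξ : ∀ l, (ξ l).isSome) (j : Fin n) : gain (lift f) ξ j = marg f (fill 0 ξ) j := by
  funext i
  rw [gain, marg]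
  rcases hk.eq_or_lt with rfl | hk
  · have h : ∀ d : Fin (1 + 1), Function.update (splice j (fill 0 ξ) fun _ => d) j d
        = splice j (fill 0 ξ) fun _ => d := fun d => by simp [splice]
    simp only [lift, if_true, fill_update, fill_splice hξ]
    rcases eq_lab i with rfl | rfl
    · rw [high_lab₀, low_lab₀, h 1]; ring
    · rw [high_lab₁, low_lab₁, h 0]; ring
  · simp only [lift, if_neg (show ¬ k = 1 by omega), fill_update, fill_splice hξ, low_eq_zero hk]

/-- For k = 1 the value 0 is itself a label, so the labeling is complete and the factor is 2; for k
≥ 2 zeros stay unlabeled. -/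
theorem exists_labeling (hk : 1 ≤ k) (o : Vec n k) :
    ∃ ω : Fin n → Option (Fin (numLabels k)), ∀ f : Vec n k → ℝ,
      lift f ω = liftFactor k * f o := by
  rcases hk.eq_or_lt with rfl | hk
  · refine ⟨fun l => some (if o l = 0 then lab₁ else lab₀), fun f => ?_⟩
    rw [lift_eq_of_isSome f (fun l => by simp)]
    congr 2
    funext l
    unfold fill
    rcases eq_zero_or_one (o l) with h | h <;> simp [h, high_lab₀, high_lab₁]
  · refine ⟨fun l => if h : o l = 0 then none else some ⟨o l - 1, ?_⟩, fun f => ?_⟩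
    · have := (o l).is_lt
      unfold numLabels
      omega
    · rw [lift, liftFactor, if_neg (by omega), if_neg (by omega), one_mul]
      congr 1
      funext l
      unfold fill
      by_cases h : o l = 0
      · simp [h]
      · have h1 : (o l : ℕ) ≠ 0 := fun h' => h (Fin.ext h')
        simp only [dif_neg h, Option.elim]
        ext
        rw [val_high hk]
        simp only
        omega

theorem lift_nonneg {f : Vec n k → ℝ} (hf : ∀ x, 0 ≤ f x)
    (ξ : Fin n → Option (Fin (numLabels k))) : 0 ≤ lift f ξ := by
  unfold lift
  split_ifs
  · exact add_nonneg (hf _) (hf _)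
  · exact hf _

theorem abs_marg_le {f : Vec n k → ℝ} (hf : ∀ x, f x ∈ Set.Icc (0 : ℝ) 1) (x : Vec n k)
    (j : Fin n) (i : Fin (numLabels k)) : |marg f x j i| ≤ 1 := by
  rw [marg, abs_le]
  constructor <;> linarith [(hf (Function.update (splice j x fun _ => low i) j (high i))).1,
    (hf (Function.update (splice j x fun _ => low i) j (high i))).2,
    (hf (splice j x fun _ => low i)).1, (hf (splice j x fun _ => low i)).2]

end Labels

/-! ### The law of a single round -/

section RoundLaw

variable {n k : ℕ}

theorem mix_posDist_isDist (G : Fin (numLabels k) → ℝ) : IsDist (mix (posDist G)) := by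
  have : Nonempty (Fin (numLabels k)) := ⟨lab₀⟩
  exact (posDist_isDist G).mix (by simpa using two_le_numLabels)

/-- The law of the play of a round, for the regret vectors `G` of the coordinates. -/
def playLaw (G : Fin n → Fin (numLabels k) → ℝ) : PMF (Vec n k) :=
  (seqLaw (fun j => mix (posDist (G j))) (fun j => mix_posDist_isDist (G j)) n).map (fill 0)

theorem expect_congr {α : Type*} [Fintype α] {μ : PMF α} {φ ψ : α → ℝ}
    (h : ∀ a ∈ μ.support, φ a = ψ a) : expect μ φ = expect μ ψ :=
  le_antisymm (expect_mono fun a ha => (h a ha).le) (expect_mono fun a ha => (h a ha).ge)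

/-- Needed for each realized play, since the learner is fed with realized gains. Plays in the
support come from complete labelings, where `gain_lift` applies. -/
theorem pairNonneg_marg (hk : 1 ≤ k) {f : Vec n k → ℝ} (hf : KSubmodular f)
    {G : Fin n → Fin (numLabels k) → ℝ} {x : Vec n k} (hx : x ∈ (playLaw G).support) (j : Fin n) :
    PairNonneg (marg f x j) := by
  obtain ⟨ξ, hξ, rfl⟩ := (PMF.mem_support_map_iff _ _ _).mp hx
  have hs : ∀ l, (ξ l).isSome := fun l =>
    (isSome_of_mem_support_seqLaw le_rfl hξ l).mpr l.is_lt
  rw [← gain_lift hk f hs]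
  exact (orthant_lift hk hf).pair _ _ (by simp [splice])

/-- The analysis of a single round in terms of the law of its play. -/
theorem round_le (hk : 1 ≤ k) {f : Vec n k → ℝ} (hf : KSubmodular f)
    (hf' : ∀ x, f x ∈ Set.Icc (0 : ℝ) 1) (G : Fin n → Fin (numLabels k) → ℝ) {o : Vec n k}
    {ω : Fin n → Option (Fin (numLabels k))} (hω : lift f ω = liftFactor k * f o) :
    liftFactor k * (f o - 2 * expect (playLaw G) f) ≤
      ∑ j, labelVal lab₀ lab₁ (fun i => expect (playLaw G) fun x =>
        regretInc (posDist (G j)) (marg f x j) i) (ω j) := by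
  have : Nonempty (Fin (numLabels k)) := ⟨lab₀⟩
  have key := le_two_mul_expect_seqLaw (orthant_lift hk hf) lab₀_ne_lab₁
    (fun j => posDist_isDist (G j)) (fun j => mix_posDist_isDist (G j)) ω
    (lift_nonneg (fun x => (hf' x).1) _)
  have hs : ∀ ξ ∈ (seqLaw (fun j => mix (posDist (G j))) (fun j => mix_posDist_isDist (G j))
      n).support, ∀ l, (ξ l).isSome := fun ξ hξ l =>
    (isSome_of_mem_support_seqLaw le_rfl hξ l).mpr l.is_lt
  rw [hω, expect_congr fun ξ hξ => lift_eq_of_isSome f (hs ξ hξ), expect_const_mul] at key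
  simp only [playLaw, expect_map]
  refine le_trans (le_of_eq ?_) (key.trans (le_of_eq ?_))
  · rw [Function.comp_def]
    ring
  · refine Finset.sum_congr rfl fun j _ => ?_
    congr 1
    funext i
    exact expect_congr fun ξ hξ => by rw [gain_lift hk f (hs ξ hξ)]; rfl

end RoundLaw

/-! ### The idealized process -/

section Idealized

variable {n k : ℕ}

/-- The regret vectors of the coordinates after the plays `h`. -/
def cumReg (adv : Adversary n k) : (t : ℕ) → (Fin t → Vec n k) → Fin n → Fin (numLabels k) → ℝ
  | 0, _ => fun _ _ => 0
  | t + 1, h => fun j i => cumReg adv t (Fin.init h) j i +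
      regretInc (posDist (cumReg adv t (Fin.init h) j))
        (marg (adv t (Fin.init h)) (h (Fin.last t)) j) i

/-- The expected increments of the regret vectors in a round. -/
def expInc (adv : Adversary n k) (t : ℕ) (h : Fin t → Vec n k) (j : Fin n)
    (i : Fin (numLabels k)) : ℝ :=
  expect (playLaw (cumReg adv t h)) fun x =>
    regretInc (posDist (cumReg adv t h j)) (marg (adv t h) x j) i

/-- The compensators of the regret vectors. -/
def cumExp (adv : Adversary n k) : (t : ℕ) → (Fin t → Vec n k) → Fin n → Fin (numLabels k) → ℝ
  | 0, _ => fun _ _ => 0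
  | t + 1, h => fun j i => cumExp adv t (Fin.init h) j i + expInc adv t (Fin.init h) j i

/-- The sum over the rounds of the conditional expectations of the rewards. -/
def cumVal (adv : Adversary n k) : (t : ℕ) → (Fin t → Vec n k) → ℝ
  | 0, _ => 0
  | t + 1, h => cumVal adv t (Fin.init h)
      + expect (playLaw (cumReg adv t (Fin.init h))) (adv t (Fin.init h))

/-- The law of the plays of the first `t` rounds. -/
def idealLaw (adv : Adversary n k) : (t : ℕ) → PMF (Fin t → Vec n k)
  | 0 => PMF.pure Fin.elim0
  | t + 1 => (idealLaw adv t).bind fun h =>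
      (playLaw (cumReg adv t h)).map fun x => (Fin.snoc h x : Fin (t + 1) → Vec n k)

theorem expect_idealLaw_succ (adv : Adversary n k) (t : ℕ) (φ : (Fin (t + 1) → Vec n k) → ℝ) :
    expect (idealLaw adv (t + 1)) φ = expect (idealLaw adv t) fun h =>
      expect (playLaw (cumReg adv t h)) fun x => φ (Fin.snoc h x : Fin (t + 1) → Vec n k) := by
  rw [idealLaw, expect_bind]
  simp only [expect_map]
  rfl

theorem sum_reward_succ (adv : Adversary n k) {t : ℕ} (h : Fin (t + 1) → Vec n k) (o : Vec n k) :
    ∑ s, reward adv h s o = ∑ s, reward adv (Fin.init h) s o + adv t (Fin.init h) o := by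
  rw [Fin.sum_univ_castSucc]
  rfl

theorem sum_reward_self_succ (adv : Adversary n k) {t : ℕ} (h : Fin (t + 1) → Vec n k) :
    ∑ s, reward adv h s (h s) = ∑ s, reward adv (Fin.init h) s (Fin.init h s)
      + adv t (Fin.init h) (h (Fin.last t)) := by
  rw [Fin.sum_univ_castSucc]
  rfl

/-- The tower property: given the history, the reward function of the round is fixed before the play
is drawn. -/
theorem expect_sum_reward (adv : Adversary n k) (t : ℕ) :
    expect (idealLaw adv t) (fun h => ∑ s, reward adv h s (h s))
      = expect (idealLaw adv t) (cumVal adv t) := by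
  induction t with
  | zero => simp [idealLaw, expect_pure, cumVal]
  | succ t ih =>
    rw [expect_idealLaw_succ, expect_idealLaw_succ]
    simp only [sum_reward_self_succ, cumVal, Fin.init_snoc, Fin.snoc_last, expect_add,
      expect_const, ih]

theorem labelVal_add (i₀ i₁ : Fin (numLabels k)) (u v : Fin (numLabels k) → ℝ)
    (o : Option (Fin (numLabels k))) :
    labelVal i₀ i₁ (fun i => u i + v i) o = labelVal i₀ i₁ u o + labelVal i₀ i₁ v o := by
  cases o
  · simp only [labelVal]; ring
  · rfl

/-- This holds for each history and not just on average, so o may depend on the whole history. It is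
the reason for working with the compensators `cumExp` instead of `cumReg`. -/
theorem sum_reward_sub_le (hk : 1 ≤ k) {adv : Adversary n k} (hadv : adv.Valid) {o : Vec n k}
    {ω : Fin n → Option (Fin (numLabels k))}
    (hω : ∀ f : Vec n k → ℝ, lift f ω = liftFactor k * f o) (t : ℕ) (h : Fin t → Vec n k) :
    liftFactor k * (∑ s, reward adv h s o - 2 * cumVal adv t h) ≤
      ∑ j, labelVal lab₀ lab₁ (cumExp adv t h j) (ω j) := by
  induction t with
  | zero =>
    have : ∀ o' : Option (Fin (numLabels k)), labelVal lab₀ lab₁ (fun _ => (0 : ℝ)) o' = 0 := by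
      intro o'; cases o' <;> simp [labelVal]
    simp [cumVal, cumExp, this]
  | succ t ih =>
    have h1 := ih (Fin.init h)
    have h2 := round_le hk (hadv t (Fin.init h)).1 (hadv t (Fin.init h)).2
      (cumReg adv t (Fin.init h)) (hω _)
    rw [sum_reward_succ]
    simp only [cumVal, cumExp, labelVal_add, Finset.sum_add_distrib]
    unfold expInc
    linarith

/-! ### The potential argument -/

/-- The potential of a coordinate. -/
def coordPot (G H : Fin (numLabels k) → ℝ) : ℝ :=
  ∑ i, max (G i) 0 ^ 2 + ∑ i, (H i - G i) ^ 2

theorem coordPot_nonneg (G H : Fin (numLabels k) → ℝ) : 0 ≤ coordPot G H :=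
  add_nonneg (Finset.sum_nonneg fun _ _ => sq_nonneg _) (Finset.sum_nonneg fun _ _ => sq_nonneg _)

/-- H_i is at most the positive part of G_i plus H_i - G_i, and each summand u satisfies u ≤ u²/(2l)
+ l/2. The linearized form, with free l, avoids expectations of square roots. -/
theorem le_of_coordPot (G H : Fin (numLabels k) → ℝ) {l : ℝ} (hl : 0 < l)
    (i : Fin (numLabels k)) : H i ≤ coordPot G H / (2 * l) + l := by
  have h1 : max (G i) 0 ^ 2 ≤ ∑ i, max (G i) 0 ^ 2 :=
    Finset.single_le_sum (f := fun i => max (G i) 0 ^ 2) (fun _ _ => sq_nonneg _)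
      (Finset.mem_univ i)
  have h2 : (H i - G i) ^ 2 ≤ ∑ i, (H i - G i) ^ 2 :=
    Finset.single_le_sum (f := fun i => (H i - G i) ^ 2) (fun _ _ => sq_nonneg _)
      (Finset.mem_univ i)
  have h3 : H i ≤ max (G i) 0 + (H i - G i) := by linarith [le_max_left (G i) 0]
  rw [← sub_le_iff_le_add, le_div_iff₀ (by positivity), coordPot]
  nlinarith [sq_nonneg (max (G i) 0 - l), sq_nonneg (H i - G i - l)]

theorem labelVal_le {v : Fin (numLabels k) → ℝ} {B : ℝ} (hv : ∀ i, v i ≤ B)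
    (i₀ i₁ : Fin (numLabels k)) (o : Option (Fin (numLabels k))) : labelVal i₀ i₁ v o ≤ B := by
  cases o with
  | none => simp only [labelVal]; linarith [hv i₀, hv i₁]
  | some i => exact hv i

theorem max_add_sq_le (a b : ℝ) : max (a + b) 0 ^ 2 ≤ max a 0 ^ 2 + 2 * (max a 0 * b) + b ^ 2 := by
  have h : max a 0 ^ 2 + 2 * (max a 0 * b) + b ^ 2 = (max a 0 + b) ^ 2 := by ring
  rw [h]
  rcases le_total (a + b) 0 with h0 | h0
  · rw [max_eq_right h0]; nlinarith [sq_nonneg (max a 0 + b)]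
  · rw [max_eq_left h0]
    exact pow_le_pow_left₀ h0 (by linarith [le_max_left a 0]) 2

theorem sum_const_label (c : ℝ) : ∑ _i : Fin (numLabels k), c = numLabels k * c := by
  simp

/-- The constant is 9 + 9, as increments are bounded by 3. The positive parts obey their bound for
every realized play, by Blackwell's condition; the martingale part obeys it in expectation only. -/
theorem expect_coordPot_le (hk : 1 ≤ k) {adv : Adversary n k} (hadv : adv.Valid) (t : ℕ)
    (h : Fin t → Vec n k) (j : Fin n) :
    expect (playLaw (cumReg adv t h)) (fun x =>
      coordPot (cumReg adv (t + 1) (Fin.snoc h x : Fin (t + 1) → Vec n k) j)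
        (cumExp adv (t + 1) (Fin.snoc h x : Fin (t + 1) → Vec n k) j)) ≤
      coordPot (cumReg adv t h j) (cumExp adv t h j) + numLabels k * 18 := by
  have hne : Nonempty (Fin (numLabels k)) := ⟨lab₀⟩
  have hc : 2 ≤ Fintype.card (Fin (numLabels k)) := by simpa using two_le_numLabels
  set G := cumReg adv t h j
  set H := cumExp adv t h j
  set μ := playLaw (cumReg adv t h)
  set g : Vec n k → Fin (numLabels k) → ℝ := fun x =>
    regretInc (posDist G) (marg (adv t h) x j)
  have hb : ∀ x i, |g x i| ≤ 3 := fun x i =>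
    (posDist_isDist G).abs_regretInc_le hc (abs_marg_le (hadv t h).2 x j) i
  simp only [cumReg, cumExp, Fin.init_snoc, Fin.snoc_last, coordPot, expect_add, expInc]
  have h1 : expect μ (fun x => ∑ i, max (G i + g x i) 0 ^ 2)
      ≤ ∑ i, max (G i) 0 ^ 2 + numLabels k * 9 := by
    rw [← expect_const μ (∑ i, max (G i) 0 ^ 2 + numLabels k * 9)]
    refine expect_mono fun x hx => ?_
    have e1 : ∑ i, max (G i + g x i) 0 ^ 2 ≤
        ∑ i, (max (G i) 0 ^ 2 + 2 * (max (G i) 0 * g x i) + 9) :=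
      Finset.sum_le_sum fun i _ => (max_add_sq_le _ _).trans (by
        nlinarith [abs_le.mp (hb x i)])
    rw [Finset.sum_add_distrib, Finset.sum_add_distrib, sum_const_label, ← Finset.mul_sum] at e1
    have e2 := sum_pos_mul_regretInc_le (G := G) hc (pairNonneg_marg hk (hadv t h).1 hx j)
    linarith
  have h2 : expect μ (fun x => ∑ i, (H i + expect μ (fun x => g x i) - (G i + g x i)) ^ 2)
      ≤ ∑ i, (H i - G i) ^ 2 + numLabels k * 9 := by
    rw [expect_sum, ← sum_const_label, ← Finset.sum_add_distrib]
    refine Finset.sum_le_sum fun i _ => ?_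
    have := expect_sq_sub_le μ (fun x => g x i) (H i - G i) 3 fun x => hb x i
    norm_num at this
    refine le_trans (le_of_eq ?_) this
    congr 1
    funext x
    ring
  linarith

theorem expect_pot_le (hk : 1 ≤ k) {adv : Adversary n k} (hadv : adv.Valid) (t : ℕ) :
    expect (idealLaw adv t) (fun h => ∑ j, coordPot (cumReg adv t h j) (cumExp adv t h j))
      ≤ t * (n * (numLabels k * 18)) := by
  induction t with
  | zero => simp [idealLaw, expect_pure, cumReg, cumExp, coordPot]
  | succ t ih =>
    rw [expect_idealLaw_succ]
    have h1 : ∀ h ∈ (idealLaw adv t).support,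
        expect (playLaw (cumReg adv t h)) (fun x => ∑ j,
          coordPot (cumReg adv (t + 1) (Fin.snoc h x : Fin (t + 1) → Vec n k) j)
            (cumExp adv (t + 1) (Fin.snoc h x : Fin (t + 1) → Vec n k) j))
        ≤ ∑ j, coordPot (cumReg adv t h j) (cumExp adv t h j) + n * (numLabels k * 18) := by
      intro h _
      rw [expect_sum]
      refine (Finset.sum_le_sum fun j _ => expect_coordPot_le hk hadv t h j).trans ?_
      simp [Finset.sum_add_distrib]
    refine (expect_mono h1).trans ?_
    rw [expect_add, expect_const]
    push_cast at ih ⊢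
    linarith

theorem one_le_liftFactor : 1 ≤ liftFactor k := by
  unfold liftFactor; split_ifs <;> norm_num

theorem expect_regret_le_of_pos (hk : 1 ≤ k) {adv : Adversary n k} (hadv : adv.Valid) (T : ℕ)
    {l : ℝ} (hl : 0 < l) :
    2 * expect (idealLaw adv T) (regret (1 / 2) adv)
      ≤ T * (n * (numLabels k * 18)) / (2 * l) + n * l := by
  have h1 : ∀ h : Fin T → Vec n k,
      Finset.univ.sup' Finset.univ_nonempty (fun o : Vec n k => ∑ t : Fin T, reward adv h t o) ≤
        (∑ j, coordPot (cumReg adv T h j) (cumExp adv T h j)) / (2 * l) + n * l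
          + 2 * cumVal adv T h := by
    intro h
    refine Finset.sup'_le _ _ fun o _ => ?_
    obtain ⟨ω, hω⟩ := exists_labeling hk o
    have e1 := sum_reward_sub_le hk hadv hω T h
    have e2 : ∑ j, labelVal lab₀ lab₁ (cumExp adv T h j) (ω j) ≤
        ∑ j, (coordPot (cumReg adv T h j) (cumExp adv T h j) / (2 * l) + l) :=
      Finset.sum_le_sum fun j _ => labelVal_le (le_of_coordPot _ _ hl) _ _ _
    have e3 : 0 ≤ ∑ j, (coordPot (cumReg adv T h j) (cumExp adv T h j) / (2 * l) + l) :=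
      Finset.sum_nonneg fun j _ =>
        add_nonneg (div_nonneg (coordPot_nonneg _ _) (by positivity)) hl.le
    have e4 : ∑ j, (coordPot (cumReg adv T h j) (cumExp adv T h j) / (2 * l) + l) =
        (∑ j, coordPot (cumReg adv T h j) (cumExp adv T h j)) / (2 * l) + n * l := by
      rw [Finset.sum_add_distrib, Finset.sum_div]; simp
    rw [e4] at e2 e3
    have e5 := one_le_liftFactor (k := k)
    have e6 := e1.trans e2
    -- The factor `liftFactor k` ≥ 1 can be dropped because the upper bound is nonnegative.
    by_contra! hlt
    nlinarith
  have h2 : ∀ h : Fin T → Vec n k, 2 * regret (1 / 2) adv h ≤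
      ((∑ j, coordPot (cumReg adv T h j) (cumExp adv T h j)) / (2 * l) + n * l
        + 2 * cumVal adv T h) - 2 * ∑ t : Fin T, reward adv h t (h t) := by
    intro h
    have := h1 h
    rw [regret]
    linarith
  rw [← expect_const_mul]
  refine (expect_mono fun h _ => h2 h).trans ?_
  simp only [expect_sub, expect_add, expect_const, expect_const_mul, div_eq_inv_mul,
    expect_sum_reward]
  have h3 := mul_le_mul_of_nonneg_left (expect_pot_le hk hadv T (n := n))
    (show 0 ≤ (2 * l)⁻¹ by positivity)
  linarith

/-- The expected regret of the idealized process. -/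
theorem expect_regret_le (hk : 1 ≤ k) {adv : Adversary n k} (hadv : adv.Valid) (T : ℕ) :
    expect (idealLaw adv T) (regret (1 / 2) adv) ≤ 6 * (k * n * Real.sqrt T) := by
  rcases Nat.eq_zero_or_pos T with rfl | hT
  · have : (regret (1 / 2) adv : (Fin 0 → Vec n k) → ℝ) = fun _ => 0 := by
      funext h
      simp [regret]
    rw [this, expect_const]
    positivity
  have hT' : (0 : ℝ) < Real.sqrt T := Real.sqrt_pos.mpr (by exact_mod_cast hT)
  have hk' : (1 : ℝ) ≤ k := by exact_mod_cast hk
  -- With 18K ≤ 36k ≤ 72k² this l makes both terms at most 6kn√T; the factor 2 in front of the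
  -- regret turns their sum into 6kn√T.
  have key := expect_regret_le_of_pos hk hadv T (l := 6 * k * Real.sqrt T) (by positivity)
  have hK : (numLabels k : ℝ) ≤ 2 * k := by
    have : numLabels k ≤ 2 * k := by unfold numLabels; omega
    exact_mod_cast this
  have h1 : (T : ℝ) * (n * (numLabels k * 18)) / (2 * (6 * k * Real.sqrt T))
      ≤ 6 * (k * n * Real.sqrt T) := by
    rw [div_le_iff₀ (by positivity)]
    have e1 : (T : ℝ) = Real.sqrt T * Real.sqrt T := (Real.mul_self_sqrt (by positivity)).symm
    have e2 : (numLabels k : ℝ) * 18 ≤ 72 * (k * k) := by nlinarith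
    calc (T : ℝ) * (n * (numLabels k * 18)) ≤ T * (n * (72 * (k * k))) := by gcongr
      _ = 6 * (k * n * Real.sqrt T) * (2 * (6 * k * Real.sqrt T)) := by
        nth_rewrite 1 [e1]; ring
  linarith

end Idealized

open scoped ENNReal

/-! ### Expectations of nonnegative functions -/

section Wexp

variable {α β : Type*}

/-- The expectation of a nonnegative function. -/
def wexp (μ : PMF α) (Φ : α → ℝ≥0∞) : ℝ≥0∞ := ∑' a, μ a * Φ a

theorem wexp_pure (a : α) (Φ : α → ℝ≥0∞) : wexp (PMF.pure a) Φ = Φ a := by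
  rw [wexp, tsum_eq_single a]
  · simp
  · intro b hb; simp [hb]

theorem wexp_bind (μ : PMF α) (ν : α → PMF β) (Φ : β → ℝ≥0∞) :
    wexp (μ.bind ν) Φ = wexp μ fun a => wexp (ν a) Φ := by
  simp only [wexp, PMF.bind_apply, ← ENNReal.tsum_mul_right, ← ENNReal.tsum_mul_left, mul_assoc]
  exact ENNReal.tsum_comm

theorem wexp_map (μ : PMF α) (g : α → β) (Φ : β → ℝ≥0∞) :
    wexp (μ.map g) Φ = wexp μ fun a => Φ (g a) := by
  rw [← PMF.bind_pure_comp, wexp_bind]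
  simp only [Function.comp_apply, wexp_pure]

theorem wexp_congr {μ : PMF α} {Φ Ψ : α → ℝ≥0∞} (h : ∀ a ∈ μ.support, Φ a = Ψ a) :
    wexp μ Φ = wexp μ Ψ := by
  refine tsum_congr fun a => ?_
  by_cases ha : a ∈ μ.support
  · rw [h a ha]
  · rw [(PMF.apply_eq_zero_iff μ a).mpr ha, zero_mul, zero_mul]

theorem wexp_const (μ : PMF α) (c : ℝ≥0∞) : wexp μ (fun _ => c) = c := by
  rw [wexp, ENNReal.tsum_mul_right, μ.tsum_coe, one_mul]

theorem wexp_add (μ : PMF α) (Φ Ψ : α → ℝ≥0∞) :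
    wexp μ (fun a => Φ a + Ψ a) = wexp μ Φ + wexp μ Ψ := by
  simp only [wexp, mul_add, ENNReal.tsum_add]

theorem wexp_const_mul (μ : PMF α) (c : ℝ≥0∞) (Φ : α → ℝ≥0∞) :
    wexp μ (fun a => c * Φ a) = c * wexp μ Φ := by
  simp only [wexp, ← ENNReal.tsum_mul_left]
  exact tsum_congr fun a => by ring

theorem map_apply_eq_wexp [DecidableEq β] (μ : PMF α) (g : α → β) (b : β) :
    μ.map g b = wexp μ fun a => if b = g a then 1 else 0 := by
  rw [PMF.map_apply]
  refine tsum_congr fun a => ?_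
  split_ifs with h <;> simp [h]

theorem wexp_coinLaw {q : ℝ} (h0 : 0 ≤ q) (h1 : q ≤ 1) (Φ : Bool → ℝ≥0∞) :
    wexp (coinLaw q) Φ = ENNReal.ofReal q * Φ true + ENNReal.ofReal (1 - q) * Φ false := by
  rw [wexp, tsum_bool, coinLaw]
  simp only [PMF.ofFintype_apply, cond_true, cond_false, min_eq_right h1, max_eq_right h0]
  rw [ENNReal.ofReal_sub _ h0, ENNReal.ofReal_one, add_comm]

end Wexp

/-! ### Reasoning about programs -/

section Programs

variable {n k : ℕ} {f : Vec n k → ℝ}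

namespace State

@[simp] theorem tick_nat (s : State) (m : ℕ) : (s.tick m).nat = s.nat := rfl

@[simp] theorem tick_real (s : State) (m : ℕ) : (s.tick m).real = s.real := rfl

@[simp] theorem setNat_real (s : State) (a i j v : ℕ) : (s.setNat a i j v).real = s.real := rfl

@[simp] theorem setReal_nat (s : State) (a i j : ℕ) (v : ℝ) : (s.setReal a i j v).nat = s.nat := rfl

@[simp] theorem setNat_nat (s : State) (a i j v a' i' j' : ℕ) : (s.setNat a i j v).nat a' i' j' =
    if a' = a ∧ i' = i ∧ j' = j then v else s.nat a' i' j' := rfl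

@[simp] theorem setReal_real (s : State) (a i j : ℕ) (v : ℝ) (a' i' j' : ℕ) :
    (s.setReal a i j v).real a' i' j' =
      if a' = a ∧ i' = i ∧ j' = j then v else s.real a' i' j' := rfl

theorem vec_apply (s : State) (a : ℕ) (j : Fin n) : s.vec n k a j = clip k (s.nat a 0 j) := rfl

end State

/-- The program does not write to the natural-number array `a`. -/
def Cmd.keepsNat (a : ℕ) : Cmd → Bool
  | .skip => true
  | .setNat b _ _ _ => b != a
  | .setReal _ _ _ _ => true
  | .coin b _ _ _ => b != a
  | .query _ _ _ _ => true
  | .seq c d => c.keepsNat a && d.keepsNat a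
  | .iteNat _ _ c d => c.keepsNat a && d.keepsNat a
  | .iteReal _ _ c d => c.keepsNat a && d.keepsNat a
  | .forLoop v _ c => v != a && c.keepsNat a

/-- The program does not write to the real array `a`. -/
def Cmd.keepsReal (a : ℕ) : Cmd → Bool
  | .skip => true
  | .setNat _ _ _ _ => true
  | .setReal b _ _ _ => b != a
  | .coin _ _ _ _ => true
  | .query b _ _ _ => b != a
  | .seq c d => c.keepsReal a && d.keepsReal a
  | .iteNat _ _ c d => c.keepsReal a && d.keepsReal a
  | .iteReal _ _ c d => c.keepsReal a && d.keepsReal a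
  | .forLoop _ _ c => c.keepsReal a

theorem iterate_induction {body : ℕ → State → PMF State} {I : ℕ → State → Prop} {s : State}
    {N : ℕ} (h0 : I 0 s)
    (hstep : ∀ m < N, ∀ s', I m s' → ∀ s'' ∈ (body m s').support, I (m + 1) s'') :
    ∀ s' ∈ (iterate body N s).support, I N s' := by
  induction N with
  | zero =>
    intro s' hs'
    rw [iterate, PMF.support_pure, Set.mem_singleton_iff] at hs'
    exact hs' ▸ h0
  | succ N ih =>
    intro s' hs'
    rw [iterate, PMF.mem_support_bind_iff] at hs'
    obtain ⟨s₁, h1, h2⟩ := hs'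
    exact hstep N (Nat.lt_succ_self N) s₁
      (ih (fun m hm => hstep m (hm.trans (Nat.lt_succ_self N))) s₁ h1) s' h2

theorem mem_support_seq {c d : Cmd} {s s' : State} :
    s' ∈ (exec n k f (.seq c d) s).support ↔
      ∃ s₁ ∈ (exec n k f c s).support, s' ∈ (exec n k f d s₁).support := by
  rw [exec, PMF.mem_support_bind_iff]

theorem mem_support_setNat {a : ℕ} {i j e : NExpr} {s s' : State}
    (h : s' ∈ (exec n k f (.setNat a i j e) s).support) :
    s'.nat = (s.setNat a (i.eval s) (j.eval s) (e.eval s)).nat ∧ s'.real = s.real := by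
  rw [exec, PMF.support_pure, Set.mem_singleton_iff] at h
  subst h
  exact ⟨rfl, rfl⟩

theorem mem_support_setReal {a : ℕ} {i j : NExpr} {e : RExpr} {s s' : State}
    (h : s' ∈ (exec n k f (.setReal a i j e) s).support) :
    s'.nat = s.nat ∧ s'.real = (s.setReal a (i.eval s) (j.eval s) (e.eval s)).real := by
  rw [exec, PMF.support_pure, Set.mem_singleton_iff] at h
  subst h
  exact ⟨rfl, rfl⟩

theorem mem_support_query {a b : ℕ} {i j : NExpr} {s s' : State}
    (h : s' ∈ (exec n k f (.query a i j b) s).support) :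
    s'.nat = s.nat ∧ s'.real = (s.setReal a (i.eval s) (j.eval s) (f (s.vec n k b))).real := by
  rw [exec, PMF.support_pure, Set.mem_singleton_iff] at h
  subst h
  exact ⟨rfl, rfl⟩

theorem mem_support_skip {s s' : State} (h : s' ∈ (exec n k f .skip s).support) :
    s'.nat = s.nat ∧ s'.real = s.real := by
  rw [exec, PMF.support_pure, Set.mem_singleton_iff] at h
  subst h
  exact ⟨rfl, rfl⟩

/-- Arrays that are not written to are unchanged. -/
def Frame (c : Cmd) (s s' : State) : Prop :=
  (∀ a, c.keepsNat a = true → s'.nat a = s.nat a) ∧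
    ∀ a, c.keepsReal a = true → s'.real a = s.real a

/-- The syntactic checks evaluate on concrete programs, so below `rfl` certifies that an array
persists. -/
theorem frame_exec {c : Cmd} {s s' : State} (h : s' ∈ (exec n k f c s).support) :
    Frame c s s' := by
  induction c generalizing s s' with
  | skip =>
    obtain ⟨h1, h2⟩ := mem_support_skip h
    exact ⟨fun a _ => by rw [h1], fun a _ => by rw [h2]⟩
  | setNat b i j e =>
    obtain ⟨h1, h2⟩ := mem_support_setNat h
    refine ⟨fun a ha => ?_, fun a _ => by rw [h2]⟩
    have : a ≠ b := fun h => by simp [Cmd.keepsNat, h] at ha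
    funext i' j'
    simp [h1, this]
  | setReal b i j e =>
    obtain ⟨h1, h2⟩ := mem_support_setReal h
    refine ⟨fun a _ => by rw [h1], fun a ha => ?_⟩
    have : a ≠ b := fun h => by simp [Cmd.keepsReal, h] at ha
    funext i' j'
    simp [h2, this]
  | coin b i j q =>
    rw [exec, PMF.mem_support_bind_iff] at h
    obtain ⟨x, -, h⟩ := h
    rw [PMF.support_pure, Set.mem_singleton_iff] at h
    subst h
    refine ⟨fun a ha => ?_, fun a _ => rfl⟩
    have : a ≠ b := fun h => by simp [Cmd.keepsNat, h] at ha
    funext i' j'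
    simp [this]
  | query b i j q =>
    obtain ⟨h1, h2⟩ := mem_support_query h
    refine ⟨fun a _ => by rw [h1], fun a ha => ?_⟩
    have : a ≠ b := fun h => by simp [Cmd.keepsReal, h] at ha
    funext i' j'
    simp [h2, this]
  | seq c d ihc ihd =>
    obtain ⟨s₁, h1, h2⟩ := mem_support_seq.mp h
    refine ⟨fun a ha => ?_, fun a ha => ?_⟩
    · rw [Cmd.keepsNat, Bool.and_eq_true] at ha
      rw [(ihd h2).1 a ha.2, (ihc h1).1 a ha.1]
    · rw [Cmd.keepsReal, Bool.and_eq_true] at ha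
      rw [(ihd h2).2 a ha.2, (ihc h1).2 a ha.1]
  | iteNat e₁ e₂ c d ihc ihd =>
    rw [exec] at h
    refine ⟨fun a ha => ?_, fun a ha => ?_⟩
    · rw [Cmd.keepsNat, Bool.and_eq_true] at ha
      split_ifs at h
      · exact (ihc h).1 a ha.1
      · exact (ihd h).1 a ha.2
    · rw [Cmd.keepsReal, Bool.and_eq_true] at ha
      split_ifs at h
      · exact (ihc h).2 a ha.1
      · exact (ihd h).2 a ha.2
  | iteReal e₁ e₂ c d ihc ihd =>
    rw [exec] at h
    refine ⟨fun a ha => ?_, fun a ha => ?_⟩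
    · rw [Cmd.keepsNat, Bool.and_eq_true] at ha
      split_ifs at h
      · exact (ihc h).1 a ha.1
      · exact (ihd h).1 a ha.2
    · rw [Cmd.keepsReal, Bool.and_eq_true] at ha
      split_ifs at h
      · exact (ihc h).2 a ha.1
      · exact (ihd h).2 a ha.2
  | forLoop v e c ih =>
    rw [exec] at h
    refine iterate_induction (I := fun _ s' => Frame (.forLoop v e c) s s')
      (s := s.tick (e.cost + 1)) ⟨fun _ _ => rfl, fun _ _ => rfl⟩ (fun m _ s₁ h1 s₂ h2 => ⟨fun a ha => ?_, fun a ha => ?_⟩)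
      s' h
    · rw [← h1.1 a ha]
      rw [Cmd.keepsNat, Bool.and_eq_true, bne_iff_ne] at ha
      rw [(ih h2).1 a ha.2]
      funext i' j'
      simp [ha.1.symm]
    · rw [← h1.2 a ha]
      exact (ih h2).2 a ha

theorem Frame.trans_body {v : ℕ} {e : NExpr} {c : Cmd} {s s' s'' : State} {m : ℕ}
    (h : Frame (.forLoop v e c) s s') (h' : Frame c ((s'.setNat v 0 0 m).tick 1) s'') :
    Frame (.forLoop v e c) s s'' := by
  refine ⟨fun a ha => ?_, fun a ha => ?_⟩
  · rw [← h.1 a ha]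
    rw [Cmd.keepsNat, Bool.and_eq_true, bne_iff_ne] at ha
    rw [h'.1 a ha.2]
    funext i' j'
    simp [ha.1.symm]
  · rw [← h.2 a ha]
    exact h'.2 a ha

/-- The body of a loop. -/
def loopBody (n k : ℕ) (f : Vec n k → ℝ) (v : ℕ) (c : Cmd) (m : ℕ) (s : State) : PMF State :=
  exec n k f c ((s.setNat v 0 0 m).tick 1)

theorem exec_forLoop (v : ℕ) (e : NExpr) (c : Cmd) (s : State) :
    exec n k f (.forLoop v e c) s
      = iterate (loopBody n k f v c) (e.eval s) (s.tick (e.cost + 1)) := rfl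

/-- The frame property is carried along with the invariant, so that the step may use the initial
contents of arrays the loop does not touch. -/
theorem iterate_frame_induction {v : ℕ} (e : NExpr) {c : Cmd} {s : State} {I : ℕ → State → Prop}
    {N q : ℕ} (h0 : I 0 (s.tick q))
    (hstep : ∀ m < N, ∀ s', Frame (.forLoop v e c) s s' → I m s' →
      ∀ s'' ∈ (loopBody n k f v c m s').support, I (m + 1) s'') :
    ∀ s' ∈ (iterate (loopBody n k f v c) N (s.tick q)).support,
      I N s' ∧ Frame (.forLoop v e c) s s' :=
  iterate_induction (I := fun m s' => I m s' ∧ Frame (.forLoop v e c) s s')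
    ⟨h0, fun _ _ => rfl, fun _ _ => rfl⟩ fun m hm s' h s'' hs'' =>
      ⟨hstep m hm s' h.2 h.1 s'' hs'', h.2.trans_body (frame_exec hs'')⟩

theorem forLoop_induction {v : ℕ} {e : NExpr} {c : Cmd} {s : State} {I : ℕ → State → Prop}
    {N : ℕ} (hN : e.eval s = N) (h0 : I 0 (s.tick (e.cost + 1)))
    (hstep : ∀ m < N, ∀ s', Frame (.forLoop v e c) s s' → I m s' →
      ∀ s'' ∈ (loopBody n k f v c m s').support, I (m + 1) s'') :
    ∀ s' ∈ (exec n k f (.forLoop v e c) s).support, I N s' := by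
  intro s' hs'
  rw [exec_forLoop, hN] at hs'
  exact (iterate_frame_induction e h0 hstep s' hs').1

/-! ### Running times -/

/-- The dimensions stand in the arrays `1` and `2`. -/
def HasParams (n k : ℕ) (s : State) : Prop :=
  s.nat 1 = (initialState n k 0).nat 1 ∧ s.nat 2 = (initialState n k 0).nat 2

theorem HasParams.dim {s : State} (h : HasParams n k s) : s.nat 1 0 0 = n := by
  rw [h.1]; simp [initialState]

theorem HasParams.label {s : State} (h : HasParams n k s) : s.nat 2 0 0 = k := by
  rw [h.2]; simp [initialState]

/-- The program does not write to the arrays `1` and `2`, and the lengths of its loops depend on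
these arrays only. -/
def Cmd.ParamLoops : Cmd → Prop
  | .seq c d => c.ParamLoops ∧ d.ParamLoops
  | .iteNat _ _ c d => c.ParamLoops ∧ d.ParamLoops
  | .iteReal _ _ c d => c.ParamLoops ∧ d.ParamLoops
  | .forLoop v e c => (v ≠ 1 ∧ v ≠ 2 ∧ c.keepsNat 1 = true ∧ c.keepsNat 2 = true) ∧
      (∀ s s' : State, s.nat 1 = s'.nat 1 → s.nat 2 = s'.nat 2 → e.eval s = e.eval s') ∧
      c.ParamLoops
  | .setNat a _ _ _ => a ≠ 1 ∧ a ≠ 2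
  | .coin a _ _ _ => a ≠ 1 ∧ a ≠ 2
  | _ => True

/-- A bound for the number of steps of a program. -/
def Cmd.bound (n k : ℕ) : Cmd → ℕ
  | .skip => 1
  | .setNat _ i j e => i.cost + j.cost + e.cost + 1
  | .setReal _ i j e => i.cost + j.cost + e.cost + 1
  | .coin _ i j q => i.cost + j.cost + q.cost + 1
  | .query _ i j _ => i.cost + j.cost + n + 1
  | .seq c d => c.bound n k + d.bound n k
  | .iteNat e₁ e₂ c d => e₁.cost + e₂.cost + 1 + (c.bound n k + d.bound n k)
  | .iteReal e₁ e₂ c d => e₁.cost + e₂.cost + 1 + (c.bound n k + d.bound n k)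
  | .forLoop _ e c => e.cost + 1 + e.eval (initialState n k 0) * (1 + c.bound n k)

theorem Cmd.ParamLoops.keeps {c : Cmd} (hc : c.ParamLoops) :
    c.keepsNat 1 = true ∧ c.keepsNat 2 = true := by
  induction c with
  | seq c d ihc ihd => simp [Cmd.keepsNat, ihc hc.1, ihd hc.2]
  | iteNat _ _ c d ihc ihd => simp [Cmd.keepsNat, ihc hc.1, ihd hc.2]
  | iteReal _ _ c d ihc ihd => simp [Cmd.keepsNat, ihc hc.1, ihd hc.2]
  | forLoop v e c ih => simp [Cmd.keepsNat, hc.1]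
  | setNat a i j e => simpa [Cmd.keepsNat, Cmd.ParamLoops] using hc
  | coin a i j e => simpa [Cmd.keepsNat, Cmd.ParamLoops] using hc
  | _ => simp [Cmd.keepsNat]

theorem HasParams.exec {c : Cmd} (hc : c.ParamLoops) {s s' : State} (hs : HasParams n k s)
    (h : s' ∈ (exec n k f c s).support) : HasParams n k s' := by
  have hF := frame_exec h
  exact ⟨(hF.1 1 hc.keeps.1).trans hs.1, (hF.1 2 hc.keeps.2).trans hs.2⟩

/-- Loop lengths depend only on the arrays holding n and k, which never change, so they can be
evaluated in the initial state with T = 0. Both branches of a conditional are charged. -/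
theorem steps_le_bound {c : Cmd} (hc : c.ParamLoops) {s s' : State} (hs : HasParams n k s)
    (h : s' ∈ (exec n k f c s).support) : s'.steps ≤ s.steps + c.bound n k := by
  induction c generalizing s s' with
  | skip | setNat | setReal | query =>
    rw [OnlineKSubmod.exec, PMF.support_pure, Set.mem_singleton_iff] at h
    subst h
    exact le_rfl
  | coin b i j q =>
    rw [OnlineKSubmod.exec, PMF.mem_support_bind_iff] at h
    obtain ⟨x, -, h⟩ := h
    rw [PMF.support_pure, Set.mem_singleton_iff] at h
    subst h
    exact le_rfl
  | seq c d ihc ihd =>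
    obtain ⟨s₁, h1, h2⟩ := mem_support_seq.mp h
    have e1 := ihc hc.1 hs h1
    have e2 := ihd hc.2 (hs.exec hc.1 h1) h2
    rw [Cmd.bound]
    omega
  | iteNat e₁ e₂ c d ihc ihd =>
    rw [OnlineKSubmod.exec] at h
    rw [Cmd.bound]
    have hs' : HasParams n k (s.tick (e₁.cost + e₂.cost + 1)) := hs
    split_ifs at h
    · have := ihc hc.1 hs' h
      simp only [State.tick] at this
      omega
    · have := ihd hc.2 hs' h
      simp only [State.tick] at this
      omega
  | iteReal e₁ e₂ c d ihc ihd =>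
    rw [OnlineKSubmod.exec] at h
    rw [Cmd.bound]
    have hs' : HasParams n k (s.tick (e₁.cost + e₂.cost + 1)) := hs
    split_ifs at h
    · have := ihc hc.1 hs' h
      simp only [State.tick] at this
      omega
    · have := ihd hc.2 hs' h
      simp only [State.tick] at this
      omega
  | forLoop v e c ih =>
    obtain ⟨⟨hv1, hv2, -, -⟩, he, hc'⟩ := hc
    rw [exec_forLoop, he s (initialState n k 0) hs.1 hs.2] at h
    have := iterate_induction (I := fun m s' => HasParams n k s' ∧
      s'.steps ≤ s.steps + (e.cost + 1) + m * (1 + c.bound n k))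
      (s := s.tick (e.cost + 1)) (body := loopBody n k f v c)
      ⟨hs, by simp [State.tick]⟩ (fun m _ s₁ h1 s₂ h2 => by
        have hp : HasParams n k ((s₁.setNat v 0 0 m).tick 1) := by
          refine ⟨(funext₂ fun i j => ?_ : _ = s₁.nat 1).trans h1.1.1,
            (funext₂ fun i j => ?_ : _ = s₁.nat 2).trans h1.1.2⟩
          · simp [hv1.symm]
          · simp [hv2.symm]
        refine ⟨hp.exec hc' h2, ?_⟩
        have e1 := ih hc' hp h2
        simp only [State.tick, State.setNat] at e1
        have e2 := h1.2
        rw [add_mul]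
        omega) s' h
    rw [Cmd.bound]
    omega

end Programs

/-! ### The algorithm -/

section Algorithm

/-- The cell `(0, 0)` of a natural-number array. -/
def cell (a : ℕ) : NExpr := .read a (.const 0) (.const 0)

/-- The cell `(0, 0)` of a real array. -/
def realCell (a : ℕ) : RExpr := .read a (.const 0) (.const 0)

/-- The entry of the current label in row `0` of a real array. -/
def realRow (a : ℕ) : RExpr := .read a (.const 0) (cell 5)

/-- The entry of the current coordinate and the current label in a real array. -/
def realMat (a : ℕ) : RExpr := .read a (cell 4) (cell 5)

/-- The number of labels. -/
def labelsExpr : NExpr := .add (cell 2) (.sub (.const 2) (cell 2))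

/-- The value of the unlabeled coordinates for the current label. -/
def lowExpr : NExpr := .sub (.add (cell 5) (.const 1)) (cell 2)

/-- The value of the current label. -/
def highExpr : NExpr := .sub (.sub (.add (cell 5) (.const 1)) lowExpr) lowExpr

/-- Add up the positive parts of the regrets of the current coordinate. -/
def posLoop : Cmd :=
  .forLoop 5 labelsExpr (.iteReal (.const 0) (realMat 0)
    (.setReal 3 (.const 0) (.const 0) (.add (realCell 3) (realMat 0))) .skip)

/-- Normalize the regret of the current label. -/
def normCell : Cmd :=
  .iteReal (realCell 3) (.const 0)
    (.setReal 6 (.const 0) (cell 5) (.div (.const 1) (.ofNat labelsExpr)))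
    (.iteReal (.const 0) (realMat 0)
      (.setReal 6 (.const 0) (cell 5) (.div (realMat 0) (realCell 3)))
      (.setReal 6 (.const 0) (cell 5) (.const 0)))

/-- Add up the excess. -/
def excessCell : Cmd :=
  .iteReal (.const (1 / 2)) (realRow 6)
    (.setReal 4 (.const 0) (.const 0) (.add (realCell 4) (.sub (realRow 6) (.const (1 / 2))))) .skip

/-- Normalize the regrets of the current coordinate, and compute the excess. -/
def normLoop : Cmd := .forLoop 5 labelsExpr (.seq normCell excessCell)

/-- Compute the probabilities and the coefficients of the labels of the current coordinate. -/
def mixLoop : Cmd :=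
  .forLoop 5 labelsExpr (.iteReal (realRow 6) (.const (1 / 2))
    (.seq
      (.setReal 1 (cell 4) (cell 5) (.add (.mul (realRow 6) (.add (.const 1) (realCell 4)))
        (.div (.mul (realCell 4) (realCell 4)) (.sub (.ofNat labelsExpr) (.const 1)))))
      (.setReal 2 (cell 4) (cell 5) (.add (.const 1) (realCell 4))))
    (.seq
      (.setReal 1 (cell 4) (cell 5) (.div (.add (.const 1) (realCell 4)) (.const 2)))
      (.setReal 2 (cell 4) (cell 5) (.sub (.const 1) (realCell 4)))))

/-- Prepare the strategy of the current coordinate: from the regrets in the array `0` compute the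
probabilities in the array `1` and the coefficients in the array `2`. -/
def prepRow : Cmd :=
  .seq (.setReal 3 (.const 0) (.const 0) (.const 0)) (.seq posLoop
    (.seq (.setReal 4 (.const 0) (.const 0) (.const 0)) (.seq normLoop mixLoop)))

/-- Choose the current label in place of the preceding ones with the appropriate probability. -/
def sampleCell : Cmd :=
  .seq (.setReal 5 (.const 0) (.const 0) (.add (realCell 5) (realMat 1)))
    (.seq (.coin 8 (.const 0) (.const 0) (.div (realMat 1) (realCell 5)))
      (.iteNat (.const 1) (cell 8) (.setNat 0 (.const 0) (cell 4) highExpr) .skip))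

/-- Sample the label of the current coordinate. -/
def sampleRow : Cmd :=
  .seq (.setReal 5 (.const 0) (.const 0) (.const 0)) (.forLoop 5 labelsExpr sampleCell)

/-- Build the vector that agrees with the play before the current coordinate. -/
def queryLoop : Cmd :=
  .forLoop 6 (cell 1) (.iteNat (.add (cell 6) (.const 1)) (cell 4)
    (.setNat 7 (.const 0) (cell 6) (.read 0 (.const 0) (cell 6)))
    (.setNat 7 (.const 0) (cell 6) lowExpr))

/-- Compute the marginal gain of the current label, and add up the mean of the gains. -/
def gainCell : Cmd :=
  .seq queryLoop (.seq (.query 8 (.const 0) (.const 0) 7)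
    (.seq (.setNat 7 (.const 0) (cell 4) highExpr) (.seq (.query 9 (.const 0) (.const 0) 7)
      (.seq (.setReal 10 (.const 0) (cell 5) (.sub (realCell 9) (realCell 8)))
        (.setReal 7 (.const 0) (.const 0)
          (.add (realCell 7) (.mul (realMat 1) (realRow 10))))))))

/-- Compute the marginal gains of the labels of the current coordinate, and their mean. -/
def gainLoop : Cmd := .forLoop 5 labelsExpr gainCell

/-- Increase the regrets of the current coordinate. -/
def regretLoop : Cmd :=
  .forLoop 5 labelsExpr (.setReal 0 (cell 4) (cell 5)
    (.add (realMat 0) (.sub (.mul (realMat 2) (realRow 10)) (realCell 7))))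

/-- Update the regrets of the current coordinate. -/
def regretRow : Cmd :=
  .seq (.setReal 7 (.const 0) (.const 0) (.const 0)) (.seq gainLoop regretLoop)

/-- The algorithm. -/
def algorithm : OnlineAlgorithm where
  init := .forLoop 4 (cell 1) prepRow
  play := .forLoop 4 (cell 1) sampleRow
  update := .forLoop 4 (cell 1) (.seq regretRow prepRow)

end Algorithm

/-! ### The deterministic parts of the algorithm -/

section Deterministic

variable {n k : ℕ} {f : Vec n k → ℝ} {s s' : State}

theorem mem_support_iteReal {e₁ e₂ : RExpr} {c d : Cmd}
    (h : s' ∈ (exec n k f (.iteReal e₁ e₂ c d) s).support) :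
    (e₁.eval s ≤ e₂.eval s ∧
        s' ∈ (exec n k f c (s.tick (e₁.cost + e₂.cost + 1))).support) ∨
      (¬ e₁.eval s ≤ e₂.eval s ∧
        s' ∈ (exec n k f d (s.tick (e₁.cost + e₂.cost + 1))).support) := by
  rw [exec] at h
  split_ifs at h with hc
  · exact Or.inl ⟨hc, h⟩
  · exact Or.inr ⟨hc, h⟩

theorem mem_support_iteNat {e₁ e₂ : NExpr} {c d : Cmd}
    (h : s' ∈ (exec n k f (.iteNat e₁ e₂ c d) s).support) :
    (e₁.eval s ≤ e₂.eval s ∧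
        s' ∈ (exec n k f c (s.tick (e₁.cost + e₂.cost + 1))).support) ∨
      (¬ e₁.eval s ≤ e₂.eval s ∧
        s' ∈ (exec n k f d (s.tick (e₁.cost + e₂.cost + 1))).support) := by
  rw [exec] at h
  split_ifs at h with hc
  · exact Or.inl ⟨hc, h⟩
  · exact Or.inr ⟨hc, h⟩

@[simp] theorem eval_cell (a : ℕ) (s : State) : (cell a).eval s = s.nat a 0 0 := rfl

@[simp] theorem eval_realCell (a : ℕ) (s : State) : (realCell a).eval s = s.real a 0 0 := rfl

@[simp] theorem eval_realRow (a : ℕ) (s : State) :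
    (realRow a).eval s = s.real a 0 (s.nat 5 0 0) := rfl

@[simp] theorem eval_realMat (a : ℕ) (s : State) :
    (realMat a).eval s = s.real a (s.nat 4 0 0) (s.nat 5 0 0) := rfl

@[simp] theorem eval_labelsExpr (s : State) :
    labelsExpr.eval s = numLabels (s.nat 2 0 0) := rfl

@[simp] theorem eval_lowExpr (s : State) :
    lowExpr.eval s = lowNat (s.nat 2 0 0) (s.nat 5 0 0) := rfl

@[simp] theorem eval_highExpr (s : State) :
    highExpr.eval s = highNat (s.nat 2 0 0) (s.nat 5 0 0) := rfl

@[simp] theorem eval_constNat (c : ℕ) (s : State) : (NExpr.const c).eval s = c := rfl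

@[simp] theorem eval_constReal (q : ℚ) (s : State) : (RExpr.const q).eval s = q := rfl

theorem posLoop_spec (hk : s.nat 2 0 0 = k) (h0 : s.real 3 0 0 = 0)
    (h : s' ∈ (exec n k f posLoop s).support) :
    s'.real 3 0 0 = ∑ l ∈ Finset.range (numLabels k), max (s.real 0 (s.nat 4 0 0) l) 0 := by
  refine forLoop_induction (I := fun m s₁ => s₁.real 3 0 0 =
    ∑ l ∈ Finset.range m, max (s.real 0 (s.nat 4 0 0) l) 0) (by simp [hk]) (by simpa using h0)
    (fun m hm s₁ hF hI s₂ h2 => ?_) s' h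
  rw [Finset.sum_range_succ, ← hI, ← hF.1 4 rfl, ← hF.2 0 rfl]
  rcases mem_support_iteReal h2 with ⟨hc, h3⟩ | ⟨hc, h3⟩
  · rw [(mem_support_setReal h3).2]
    simp [RExpr.eval] at hc ⊢
    exact hc
  · rw [(mem_support_skip h3).2]
    simp at hc ⊢
    exact hc.le

/-- The normalized positive part, in terms of its sum. -/
def normVal (K : ℕ) (W x : ℝ) : ℝ := if W ≤ 0 then 1 / (K : ℝ) else max x 0 / W

theorem normCell_spec (hk : s.nat 2 0 0 = k) (h : s' ∈ (exec n k f normCell s).support) :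
    s'.real 6 0 (s.nat 5 0 0) = normVal (numLabels k) (s.real 3 0 0)
      (s.real 0 (s.nat 4 0 0) (s.nat 5 0 0)) ∧
    ∀ l ≠ s.nat 5 0 0, s'.real 6 0 l = s.real 6 0 l := by
  unfold normVal
  rcases mem_support_iteReal h with ⟨hc, h1⟩ | ⟨hc, h1⟩
  · rw [(mem_support_setReal h1).2]
    simp [RExpr.eval] at hc
    rw [if_pos hc]
    refine ⟨by simp [RExpr.eval, hk], fun l hl => by simp [hl]⟩
  simp at hc
  rw [if_neg (not_le.mpr hc)]
  rcases mem_support_iteReal h1 with ⟨hd, h2⟩ | ⟨hd, h2⟩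
  · rw [(mem_support_setReal h2).2]
    simp at hd
    rw [max_eq_left hd]
    refine ⟨by simp [RExpr.eval], fun l hl => by simp [hl]⟩
  · rw [(mem_support_setReal h2).2]
    simp at hd
    rw [max_eq_right hd.le]
    refine ⟨by simp, fun l hl => by simp [hl]⟩

theorem excessCell_spec (h : s' ∈ (exec n k f excessCell s).support) :
    s'.real 4 0 0 = s.real 4 0 0 + max (s.real 6 0 (s.nat 5 0 0) - 1 / 2) 0 := by
  rcases mem_support_iteReal h with ⟨hc, h1⟩ | ⟨hc, h1⟩
  · rw [(mem_support_setReal h1).2]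
    simp [RExpr.eval] at hc ⊢
    exact hc
  · rw [(mem_support_skip h1).2]
    simp at hc ⊢
    linarith

theorem normLoop_spec (hk : s.nat 2 0 0 = k) (h0 : s.real 4 0 0 = 0)
    (h : s' ∈ (exec n k f normLoop s).support) :
    (∀ l < numLabels k, s'.real 6 0 l = normVal (numLabels k) (s.real 3 0 0)
      (s.real 0 (s.nat 4 0 0) l)) ∧
    s'.real 4 0 0 = ∑ l ∈ Finset.range (numLabels k),
      max (normVal (numLabels k) (s.real 3 0 0) (s.real 0 (s.nat 4 0 0) l) - 1 / 2) 0 := by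
  refine forLoop_induction (I := fun m s₁ => (∀ l < m, s₁.real 6 0 l =
    normVal (numLabels k) (s.real 3 0 0) (s.real 0 (s.nat 4 0 0) l)) ∧
    s₁.real 4 0 0 = ∑ l ∈ Finset.range m,
      max (normVal (numLabels k) (s.real 3 0 0) (s.real 0 (s.nat 4 0 0) l) - 1 / 2) 0)
    (by simp [hk]) ⟨by simp, by simpa using h0⟩ (fun m hm s₁ hF hI s₂ h2 => ?_) s' h
  rw [Finset.sum_range_succ, ← hI.2]
  simp only [← hF.1 4 rfl, ← hF.2 0 rfl, ← hF.2 3 rfl] at hI ⊢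
  obtain ⟨s₃, h3, h4⟩ := mem_support_seq.mp h2
  have h5 := normCell_spec (by simpa using (congrFun₂ (hF.1 2 rfl) 0 0).trans hk) h3
  have h6 := excessCell_spec h4
  have hF4 := frame_exec h4
  have hF3 := frame_exec h3
  rw [hF4.2 6 rfl, h6, hF3.2 4 rfl, hF3.1 5 rfl]
  simp at h5 ⊢
  refine ⟨fun l hl => ?_, by rw [h5.1]⟩
  rcases hl.lt_or_eq with hl | rfl
  · rw [h5.2 l hl.ne, hI.1 l hl]
  · exact h5.1

theorem mixLoop_spec (hk : s.nat 2 0 0 = k) (h : s' ∈ (exec n k f mixLoop s).support) :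
    (∀ l < numLabels k,
      s'.real 1 (s.nat 4 0 0) l = (if s.real 6 0 l ≤ 1 / 2 then
        s.real 6 0 l * (1 + s.real 4 0 0) + s.real 4 0 0 * s.real 4 0 0 / ((numLabels k : ℝ) - 1)
        else (1 + s.real 4 0 0) / 2) ∧
      s'.real 2 (s.nat 4 0 0) l =
        if s.real 6 0 l ≤ 1 / 2 then 1 + s.real 4 0 0 else 1 - s.real 4 0 0) ∧
    ∀ j ≠ s.nat 4 0 0, ∀ l, s'.real 1 j l = s.real 1 j l ∧ s'.real 2 j l = s.real 2 j l := by
  refine forLoop_induction (I := fun m s₁ => (∀ l < m,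
      s₁.real 1 (s.nat 4 0 0) l = (if s.real 6 0 l ≤ 1 / 2 then
        s.real 6 0 l * (1 + s.real 4 0 0) + s.real 4 0 0 * s.real 4 0 0 / ((numLabels k : ℝ) - 1)
        else (1 + s.real 4 0 0) / 2) ∧
      s₁.real 2 (s.nat 4 0 0) l =
        if s.real 6 0 l ≤ 1 / 2 then 1 + s.real 4 0 0 else 1 - s.real 4 0 0) ∧
    ∀ j ≠ s.nat 4 0 0, ∀ l, s₁.real 1 j l = s.real 1 j l ∧ s₁.real 2 j l = s.real 2 j l)
    (by simp [hk]) ⟨by simp, by simp⟩ (fun m hm s₁ hF hI s₂ h2 => ?_) s' h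
  have hk₁ : s₁.nat 2 0 0 = k := (congrFun₂ (hF.1 2 rfl) 0 0).trans hk
  simp only [← hF.1 4 rfl, ← hF.2 6 rfl, ← hF.2 4 rfl] at hI ⊢
  rcases mem_support_iteReal h2 with ⟨hc, h3⟩ | ⟨hc, h3⟩ <;>
  · obtain ⟨s₃, h3, h4⟩ := mem_support_seq.mp h3
    obtain ⟨e1, e2⟩ := mem_support_setReal h3
    obtain ⟨e3, e4⟩ := mem_support_setReal h4
    rw [e4]
    simp [RExpr.eval] at hc
    simp [RExpr.eval, e1, e2, hk₁]
    refine ⟨fun l hl => ?_, fun j hj l => ?_⟩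
    · rcases hl.lt_or_eq with hl | rfl
      · have := hI.1 l hl
        simp [hl.ne] at this ⊢
        exact this
      · simp [hc]
    · simp [hj]
      exact hI.2 j hj l

end Deterministic

/-! ### Correctness of the preparation and of the regret update -/

section Updates

variable {n k : ℕ} {f : Vec n k → ℝ} {s s' : State}

theorem posDist_eq_normVal (g : ℕ → ℝ) (i : Fin (numLabels k)) :
    posDist (fun l : Fin (numLabels k) => g l) i
      = normVal (numLabels k) (∑ l ∈ Finset.range (numLabels k), max (g l) 0) (g i) := by
  rw [posDist, normVal, Fin.sum_univ_eq_sum_range (fun l => max (g l) 0), Fintype.card_fin]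

theorem prepRow_spec (hk : s.nat 2 0 0 = k) (h : s' ∈ (exec n k f prepRow s).support) :
    (∀ i : Fin (numLabels k),
      s'.real 1 (s.nat 4 0 0) i
        = mix (posDist fun l : Fin (numLabels k) => s.real 0 (s.nat 4 0 0) l) i ∧
      s'.real 2 (s.nat 4 0 0) i
        = coef (posDist fun l : Fin (numLabels k) => s.real 0 (s.nat 4 0 0) l) i) ∧
    ∀ j ≠ s.nat 4 0 0, ∀ l, s'.real 1 j l = s.real 1 j l ∧ s'.real 2 j l = s.real 2 j l := by
  obtain ⟨s₁, h1, h⟩ := mem_support_seq.mp h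
  obtain ⟨s₂, h2, h⟩ := mem_support_seq.mp h
  obtain ⟨s₃, h3, h⟩ := mem_support_seq.mp h
  obtain ⟨s₄, h4, h5⟩ := mem_support_seq.mp h
  have F1 := frame_exec h1
  have F2 := frame_exec h2
  have F3 := frame_exec h3
  have F4 := frame_exec h4
  have N2 : s₂.nat 2 = s.nat 2 := (F2.1 2 rfl).trans (F1.1 2 rfl)
  have N4 : s₄.nat 2 = s.nat 2 := (F4.1 2 rfl).trans ((F3.1 2 rfl).trans N2)
  have J1 : s₁.nat 4 = s.nat 4 := F1.1 4 rfl
  have J3 : s₃.nat 4 = s.nat 4 := (F3.1 4 rfl).trans ((F2.1 4 rfl).trans J1)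
  have J4 : s₄.nat 4 = s.nat 4 := (F4.1 4 rfl).trans J3
  have R1 : s₁.real 0 = s.real 0 := F1.2 0 rfl
  have R3 : s₃.real 0 = s.real 0 := (F3.2 0 rfl).trans ((F2.2 0 rfl).trans R1)
  have P : ∀ a, a = 1 ∨ a = 2 → s₄.real a = s.real a := by
    rintro a (rfl | rfl)
    · exact (F4.2 1 rfl).trans ((F3.2 1 rfl).trans ((F2.2 1 rfl).trans (F1.2 1 rfl)))
    · exact (F4.2 2 rfl).trans ((F3.2 2 rfl).trans ((F2.2 2 rfl).trans (F1.2 2 rfl)))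
  have W := posLoop_spec (by rw [F1.1 2 rfl, hk]) (by rw [(mem_support_setReal h1).2]; simp) h2
  rw [J1, R1] at W
  have Q := normLoop_spec (by rw [F3.1 2 rfl, N2, hk])
    (by rw [(mem_support_setReal h3).2]; simp) h4
  rw [J3, R3, F3.2 3 rfl, W] at Q
  have M := mixLoop_spec (by rw [N4, hk]) h5
  rw [J4, P 1 (Or.inl rfl), P 2 (Or.inr rfl)] at M
  refine ⟨fun i => ?_, M.2⟩
  have hE : excess (posDist fun l : Fin (numLabels k) => s.real 0 (s.nat 4 0 0) l)
      = s₄.real 4 0 0 := by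
    rw [Q.2, excess, ← Fin.sum_univ_eq_sum_range]
    exact Finset.sum_congr rfl fun l _ => by rw [posDist_eq_normVal]
  have hr := posDist_eq_normVal (s.real 0 (s.nat 4 0 0)) i
  rw [← Q.1 i i.is_lt] at hr
  rw [mix, coef, hE, hr, Fintype.card_fin]
  exact M.1 i i.is_lt

theorem vec_eq_of_nat_eq (h : s'.nat 0 = s.nat 0) : s'.vec n k 0 = s.vec n k 0 := by
  funext l
  rw [State.vec_apply, State.vec_apply, h]

theorem queryLoop_spec (hn : s.nat 1 0 0 = n) (hk : s.nat 2 0 0 = k)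
    (h : s' ∈ (exec n k f queryLoop s).support) :
    s'.vec n k 7 = splice (s.nat 4 0 0) (s.vec n k 0) fun _ => clip k (lowNat k (s.nat 5 0 0)) := by
  have key : ∀ l < n, s'.nat 7 0 l =
      if l < s.nat 4 0 0 then s.nat 0 0 l else lowNat k (s.nat 5 0 0) := by
    refine forLoop_induction (I := fun m s₁ => ∀ l < m, s₁.nat 7 0 l =
      if l < s.nat 4 0 0 then s.nat 0 0 l else lowNat k (s.nat 5 0 0)) (by simp [hn]) (by simp)
      (fun m hm s₁ hF hI s₂ h2 => ?_) s' h
    have hk₁ : s₁.nat 2 0 0 = k := (congrFun₂ (hF.1 2 rfl) 0 0).trans hk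
    simp only [← hF.1 4 rfl, ← hF.1 5 rfl, ← hF.1 0 rfl] at hI ⊢
    intro l hl
    rcases mem_support_iteNat h2 with ⟨hc, h3⟩ | ⟨hc, h3⟩ <;>
    · rw [(mem_support_setNat h3).1]
      simp [NExpr.eval] at hc
      simp [NExpr.eval, hk₁]
      rcases (Nat.lt_succ_iff.mp hl).lt_or_eq with hl | rfl
      · simpa [hl.ne] using hI l hl
      · simp
        omega
  funext l
  rw [State.vec_apply, key l l.is_lt, splice]
  split_ifs <;> rfl

/-- The marginal gain with the label given by its index. -/
def margNat (f : Vec n k → ℝ) (x : Vec n k) (j : Fin n) (i : ℕ) : ℝ :=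
  f (Function.update (splice j x fun _ => clip k (lowNat k i)) j (clip k (highNat k i)))
    - f (splice j x fun _ => clip k (lowNat k i))

theorem margNat_val (f : Vec n k → ℝ) (x : Vec n k) (j : Fin n) (i : Fin (numLabels k)) :
    margNat f x j i = marg f x j i := rfl

theorem gainCell_spec (hn : s.nat 1 0 0 = n) (hk : s.nat 2 0 0 = k) {j : Fin n}
    (hj : s.nat 4 0 0 = j) (h : s' ∈ (exec n k f gainCell s).support) :
    s'.real 10 0 (s.nat 5 0 0) = margNat f (s.vec n k 0) j (s.nat 5 0 0) ∧
    (∀ l ≠ s.nat 5 0 0, s'.real 10 0 l = s.real 10 0 l) ∧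
    s'.real 7 0 0 = s.real 7 0 0
      + s.real 1 j (s.nat 5 0 0) * margNat f (s.vec n k 0) j (s.nat 5 0 0) := by
  obtain ⟨s₁, h1, h⟩ := mem_support_seq.mp h
  obtain ⟨s₂, h2, h⟩ := mem_support_seq.mp h
  obtain ⟨s₃, h3, h⟩ := mem_support_seq.mp h
  obtain ⟨s₄, h4, h⟩ := mem_support_seq.mp h
  obtain ⟨s₅, h5, h6⟩ := mem_support_seq.mp h
  have F1 := frame_exec h1
  have V1 := queryLoop_spec hn hk h1
  rw [hj] at V1
  obtain ⟨n2, r2⟩ := mem_support_query h2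
  obtain ⟨n3, r3⟩ := mem_support_setNat h3
  obtain ⟨n4, r4⟩ := mem_support_query h4
  obtain ⟨n5, r5⟩ := mem_support_setReal h5
  obtain ⟨n6, r6⟩ := mem_support_setReal h6
  have V3 : s₃.vec n k 7 = Function.update
      (splice j (s.vec n k 0) fun _ => clip k (lowNat k (s.nat 5 0 0))) j
      (clip k (highNat k (s.nat 5 0 0))) := by
    rw [← V1]
    funext l
    rw [State.vec_apply, n3]
    simp [n2, F1.1 2 rfl, F1.1 4 rfl, F1.1 5 rfl, hk, hj]
    by_cases hl : l = j
    · subst hl; simp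
    · have : (l : ℕ) ≠ j := fun h => hl (Fin.ext h)
      simp [hl, this, State.vec_apply]
  rw [r6]
  simp [RExpr.eval, n5, r5, n4, r4, n3, r3, n2, r2, V1, V3, F1.1 4 rfl, F1.1 5 rfl, F1.2 7 rfl,
    F1.2 1 rfl, F1.2 10 rfl, hj, margNat]
  intro l hl h'
  exact absurd h' hl

theorem gainLoop_spec (hn : s.nat 1 0 0 = n) (hk : s.nat 2 0 0 = k) {j : Fin n}
    (hj : s.nat 4 0 0 = j) (h0 : s.real 7 0 0 = 0) (h : s' ∈ (exec n k f gainLoop s).support) :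
    (∀ l < numLabels k, s'.real 10 0 l = margNat f (s.vec n k 0) j l) ∧
    s'.real 7 0 0 = ∑ l ∈ Finset.range (numLabels k),
      s.real 1 j l * margNat f (s.vec n k 0) j l := by
  refine forLoop_induction (I := fun m s₁ =>
    (∀ l < m, s₁.real 10 0 l = margNat f (s.vec n k 0) j l) ∧
    s₁.real 7 0 0 = ∑ l ∈ Finset.range m, s.real 1 j l * margNat f (s.vec n k 0) j l)
    (by simp [hk]) ⟨by simp, by simpa using h0⟩ (fun m hm s₁ hF hI s₂ h2 => ?_) s' h
  have h5 := gainCell_spec (by simpa using (congrFun₂ (hF.1 1 rfl) 0 0).trans hn)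
    (by simpa using (congrFun₂ (hF.1 2 rfl) 0 0).trans hk)
    (by simpa using (congrFun₂ (hF.1 4 rfl) 0 0).trans hj) h2
  rw [vec_eq_of_nat_eq (s := s) (by
    rw [← hF.1 0 rfl]; funext a b; simp)] at h5
  rw [Finset.sum_range_succ, ← hI.2]
  simp [hF.2 1 rfl] at h5
  refine ⟨fun l hl => ?_, h5.2.2⟩
  rcases (Nat.lt_succ_iff.mp hl).lt_or_eq with hl | rfl
  · rw [h5.2.1 l hl.ne, hI.1 l hl]
  · exact h5.1

theorem regretLoop_spec (hk : s.nat 2 0 0 = k) (h : s' ∈ (exec n k f regretLoop s).support) :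
    (∀ l < numLabels k, s'.real 0 (s.nat 4 0 0) l = s.real 0 (s.nat 4 0 0) l
      + (s.real 2 (s.nat 4 0 0) l * s.real 10 0 l - s.real 7 0 0)) ∧
    ∀ j ≠ s.nat 4 0 0, ∀ l, s'.real 0 j l = s.real 0 j l := by
  -- The row is overwritten in place, so the invariant must also say that the entries from m on are
  -- still the old ones.
  have key := forLoop_induction (I := fun m s₁ => (∀ l, s₁.real 0 (s.nat 4 0 0) l =
      if l < m then s.real 0 (s.nat 4 0 0) l
        + (s.real 2 (s.nat 4 0 0) l * s.real 10 0 l - s.real 7 0 0)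
      else s.real 0 (s.nat 4 0 0) l) ∧
    ∀ j ≠ s.nat 4 0 0, ∀ l, s₁.real 0 j l = s.real 0 j l) (N := numLabels k)
    (by simp [hk]) ⟨by simp, by simp⟩ (fun m hm s₁ hF hI s₂ h2 => by
      rw [(mem_support_setReal h2).2]
      have e4 := congrFun₂ (hF.1 4 rfl) 0 0
      simp [RExpr.eval, e4]
      refine ⟨fun l => ?_, fun j hj l => ?_⟩
      · rcases lt_trichotomy l m with hl | rfl | hl
        · simpa [hl.ne, hl, Nat.lt_succ_of_lt hl, hl.le] using hI.1 l
        · simpa [hF.2 2 rfl, hF.2 10 rfl, hF.2 7 rfl] using hI.1 l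
        · simpa [hl.ne', not_le.mpr hl, hl.not_gt] using hI.1 l
      · simpa [hj] using hI.2 j hj l) s' h
  exact ⟨fun l hl => by rw [key.1, if_pos hl], key.2⟩

theorem regretRow_spec (hn : s.nat 1 0 0 = n) (hk : s.nat 2 0 0 = k) {j : Fin n}
    (hj : s.nat 4 0 0 = j) {r : Fin (numLabels k) → ℝ} (h1 : ∀ i : Fin (numLabels k), s.real 1 j i = mix r i)
    (h2 : ∀ i : Fin (numLabels k), s.real 2 j i = coef r i) (h : s' ∈ (exec n k f regretRow s).support) :
    (∀ i : Fin (numLabels k), s'.real 0 j i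
      = s.real 0 j i + regretInc r (marg f (s.vec n k 0) j) i) ∧
    ∀ j' ≠ (j : ℕ), ∀ l, s'.real 0 j' l = s.real 0 j' l := by
  obtain ⟨s₁, e1, h⟩ := mem_support_seq.mp h
  obtain ⟨s₂, e2, e3⟩ := mem_support_seq.mp h
  have F1 := frame_exec e1
  have F2 := frame_exec e2
  have G := gainLoop_spec (j := j) (by rw [F1.1 1 rfl, hn]) (by rw [F1.1 2 rfl, hk])
    (by rw [F1.1 4 rfl, hj]) (by rw [(mem_support_setReal e1).2]; simp) e2
  rw [vec_eq_of_nat_eq (F1.1 0 rfl), F1.2 1 rfl] at G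
  have R := regretLoop_spec (by rw [F2.1 2 rfl, F1.1 2 rfl, hk]) e3
  rw [F2.1 4 rfl, F1.1 4 rfl, hj, F2.2 0 rfl, F1.2 0 rfl, F2.2 2 rfl, F1.2 2 rfl] at R
  refine ⟨fun i => ?_, R.2⟩
  rw [R.1 i i.is_lt, G.1 i i.is_lt, G.2, h2, regretInc, ← Fin.sum_univ_eq_sum_range]
  simp only [margNat_val, h1]

/-- The memory holds the regret vectors `G`, the probabilities and the coefficients. -/
def Holds (G : Fin n → Fin (numLabels k) → ℝ) (s : State) (j : Fin n) : Prop :=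
  ∀ i : Fin (numLabels k), s.real 0 j i = G j i ∧ s.real 1 j i = mix (posDist (G j)) i ∧
    s.real 2 j i = coef (posDist (G j)) i

theorem Holds.congr {G : Fin n → Fin (numLabels k) → ℝ} {j : Fin n} (h : Holds G s j)
    (h' : ∀ a ≤ 2, s'.real a j = s.real a j) : Holds G s' j := by
  intro i
  rw [h' 0 (by omega), h' 1 (by omega), h' 2 le_rfl]
  exact h i

theorem init_spec (hs : HasParams n k s) (hG : s.real 0 = fun _ _ => 0)
    (h : s' ∈ (exec n k f algorithm.init s).support) (j : Fin n) :
    Holds (k := k) (fun _ _ => (0 : ℝ)) s' j := by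
  refine forLoop_induction (I := fun m s₁ => ∀ j : Fin n, (j : ℕ) < m →
    Holds (k := k) (fun _ _ => (0 : ℝ)) s₁ j) (by simp [hs.dim]) (by simp)
    (fun m hm s₁ hF hI s₂ h2 => ?_) s' h j j.is_lt
  have hP := prepRow_spec (by simpa using (congrFun₂ (hF.1 2 rfl) 0 0).trans hs.label) h2
  have F2 := frame_exec h2
  simp [hF.2 0 rfl, hG] at hP
  intro l hl
  rcases (Nat.lt_succ_iff.mp hl).lt_or_eq with hl | rfl
  · refine (hI l hl).congr fun a ha => ?_
    interval_cases a
    · rw [F2.2 0 rfl]; rfl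
    · exact funext fun i => (hP.2 l hl.ne i).1
    · exact funext fun i => (hP.2 l hl.ne i).2
  · intro i
    rw [F2.2 0 rfl]
    exact ⟨by simp [hF.2 0 rfl, hG], hP.1 i⟩

theorem update_spec (hs : HasParams n k s) {G : Fin n → Fin (numLabels k) → ℝ}
    (hG : ∀ j, Holds G s j) (h : s' ∈ (exec n k f algorithm.update s).support) (j : Fin n) :
    Holds (fun j i => G j i + regretInc (posDist (G j)) (marg f (s.vec n k 0) j) i) s' j := by
  -- Coordinates before m are new, those from m on are old. The old probabilities and coefficients
  -- of m are still needed for its regret increment before they are recomputed.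
  refine (forLoop_induction (I := fun m s₁ =>
    (∀ j : Fin n, (j : ℕ) < m → Holds (fun j i =>
      G j i + regretInc (posDist (G j)) (marg f (s.vec n k 0) j) i) s₁ j) ∧
    ∀ j : Fin n, m ≤ j → Holds G s₁ j) (by simp [hs.dim]) ⟨by simp, fun j _ => hG j⟩
    (fun m hm s₁ hF hI s₂ h2 => ?_) s' h).1 j j.is_lt
  set s₀ := (s₁.setNat 4 0 0 m).tick 1 with hs₀
  have hn₀ : s₀.nat 1 0 0 = n := by simpa [hs₀] using (congrFun₂ (hF.1 1 rfl) 0 0).trans hs.dim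
  have hk₀ : s₀.nat 2 0 0 = k := by simpa [hs₀] using (congrFun₂ (hF.1 2 rfl) 0 0).trans hs.label
  have hj₀ : s₀.nat 4 0 0 = m := by simp [hs₀]
  have hv₀ : s₀.vec n k 0 = s.vec n k 0 := vec_eq_of_nat_eq (by
    rw [← hF.1 0 rfl]; funext a b; simp [hs₀])
  obtain ⟨s₃, h3, h4⟩ := mem_support_seq.mp h2
  have F3 := frame_exec h3
  have F4 := frame_exec h4
  have hGm := hI.2 ⟨m, hm⟩ le_rfl
  have hR := regretRow_spec (j := ⟨m, hm⟩) hn₀ hk₀ hj₀ (fun i => (hGm i).2.1)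
    (fun i => (hGm i).2.2) h3
  have hP := prepRow_spec (by rw [F3.1 2 rfl, hk₀]) h4
  rw [F3.1 4 rfl, hj₀, F3.2 1 rfl, F3.2 2 rfl] at hP
  rw [hv₀] at hR
  have hR' : ∀ i : Fin (numLabels k), s₃.real 0 m i = G ⟨m, hm⟩ i
      + regretInc (posDist (G ⟨m, hm⟩)) (marg f (s.vec n k 0) ⟨m, hm⟩) i := by
    intro i
    rw [hR.1 i, ← (hGm i).1]
    rfl
  have hcongr : ∀ l : Fin n, (l : ℕ) ≠ m → ∀ a ≤ 2, s₂.real a l = s₁.real a l := by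
    intro l hl a ha
    interval_cases a
    · rw [F4.2 0 rfl]; exact funext fun i => hR.2 l hl i
    · exact funext fun i => (hP.2 l hl i).1
    · exact funext fun i => (hP.2 l hl i).2
  refine ⟨fun l hl => ?_, fun l hl => (hI.2 l (by omega)).congr (hcongr l (by omega))⟩
  rcases (Nat.lt_succ_iff.mp hl).lt_or_eq with hl | rfl
  · exact (hI.1 l hl).congr (hcongr l hl.ne)
  · intro i
    rw [F4.2 0 rfl]
    refine ⟨hR' i, ?_⟩
    have := hP.1 i
    simp only [hR'] at this
    exact this

end Updates

/-! ### The law of the plays -/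

section Sampling

variable {n k : ℕ} {f : Vec n k → ℝ}

theorem wexp_sampleCell {s : State} (hk : s.nat 2 0 0 = k) {j : ℕ} (hj : s.nat 4 0 0 = j)
    {q : ℝ} (hq : s.real 1 j (s.nat 5 0 0) / (s.real 5 0 0 + s.real 1 j (s.nat 5 0 0)) = q)
    (h0 : 0 ≤ q) (h1 : q ≤ 1) (Φ : ℕ → ℝ≥0∞) :
    wexp (exec n k f sampleCell s) (fun s' => Φ (s'.nat 0 0 j))
      = ENNReal.ofReal q * Φ (highNat k (s.nat 5 0 0))
        + ENNReal.ofReal (1 - q) * Φ (s.nat 0 0 j) := by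
  subst hj
  refine Eq.trans ?_ (wexp_coinLaw h0 h1 fun b => cond b (Φ (highNat k (s.nat 5 0 0)))
    (Φ (s.nat 0 0 (s.nat 4 0 0))))
  simp only [sampleCell, exec, PMF.pure_bind, wexp_bind, wexp_pure]
  simp only [RExpr.eval, eval_realCell, eval_realMat, State.tick_nat, State.tick_real,
    State.setReal_nat, State.setReal_real, eval_constNat, and_self, if_true]
  simp only [OfNat.one_ne_ofNat, false_and, if_false, hq]
  congr 1
  funext b
  cases b
  · simp [wexp_pure]
  · simp [wexp_pure, hk]

/-- Reservoir sampling: label i replaces the current choice with probability p_i/(p_0 + … + p_i).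
After m labels the choice has the law p conditioned on the first m labels, if these have positive
mass. -/
theorem wexp_sampleRow {s : State} (hk : s.nat 2 0 0 = k) {j : ℕ} (hj : s.nat 4 0 0 = j)
    (h0 : ∀ i < numLabels k, 0 ≤ s.real 1 j i)
    (h1 : ∑ i ∈ Finset.range (numLabels k), s.real 1 j i = 1) (Φ : ℕ → ℝ≥0∞) :
    wexp (exec n k f sampleRow s) (fun s' => Φ (s'.nat 0 0 j))
      = ∑ i ∈ Finset.range (numLabels k), ENNReal.ofReal (s.real 1 j i) * Φ (highNat k i) := by
  rw [sampleRow, exec, wexp_bind, exec, wexp_pure, exec_forLoop]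
  set s₀ := (s.setReal 5 ((NExpr.const 0).eval s) ((NExpr.const 0).eval s)
    ((RExpr.const 0).eval s)).tick ((NExpr.const 0).cost + (NExpr.const 0).cost
      + (RExpr.const 0).cost + 1) with hs₀
  have hr : s₀.real 1 = s.real 1 := by funext a b; simp [hs₀]
  have h50 : s₀.real 5 0 0 = 0 := by simp [hs₀]
  rw [eval_labelsExpr, show s₀.nat 2 0 0 = k from hk]
  -- The running sum is the same for every outcome of the coins, so the bias of each coin is a
  -- constant.
  have hsup : ∀ m, ∀ s' ∈ (iterate (loopBody n k f 5 sampleCell) m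
      (s₀.tick (labelsExpr.cost + 1))).support,
      s'.real 5 0 0 = ∑ i ∈ Finset.range m, s.real 1 j i ∧
        Frame (.forLoop 5 labelsExpr sampleCell) s₀ s' := by
    intro m
    refine iterate_frame_induction (I := fun m s' =>
      s'.real 5 0 0 = ∑ i ∈ Finset.range m, s.real 1 j i) labelsExpr (by simpa using h50)
      fun m _ s₁ hF hI s₂ h2 => ?_
    obtain ⟨s₃, h3, h4⟩ := mem_support_seq.mp h2
    rw [(frame_exec h4).2 5 rfl, (mem_support_setReal h3).2, Finset.sum_range_succ, ← hI, ← hr,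
      ← hF.2 1 rfl]
    have e4 : s₁.nat 4 0 0 = j := (congrFun₂ (hF.1 4 rfl) 0 0).trans hj
    simp [RExpr.eval, e4]
  -- Multiplying by the prefix mass makes the claim meaningful while this mass is 0; whatever the
  -- cell then contains has weight 0.
  have key : ∀ m ≤ numLabels k, ENNReal.ofReal (∑ i ∈ Finset.range m, s.real 1 j i) *
      wexp (iterate (loopBody n k f 5 sampleCell) m (s₀.tick (labelsExpr.cost + 1)))
        (fun s' => Φ (s'.nat 0 0 j))
      = ∑ i ∈ Finset.range m, ENNReal.ofReal (s.real 1 j i) * Φ (highNat k i) := by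
    intro m hm
    induction m with
    | zero => simp
    | succ m ih =>
      have hpm : 0 ≤ s.real 1 j m := h0 m hm
      have hP : 0 ≤ ∑ i ∈ Finset.range m, s.real 1 j i :=
        Finset.sum_nonneg fun i hi => h0 i (by have := Finset.mem_range.mp hi; omega)
      set P := ∑ i ∈ Finset.range m, s.real 1 j i with hPdef
      have ih := ih (by omega)
      rw [Finset.sum_range_succ, Finset.sum_range_succ, ← ih, iterate, wexp_bind, ← hPdef]
      have hq0 : 0 ≤ s.real 1 j m / (P + s.real 1 j m) := by positivity
      have hq1 : s.real 1 j m / (P + s.real 1 j m) ≤ 1 :=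
        div_le_one_of_le₀ (by linarith) (by linarith)
      rw [wexp_congr fun s₁ h₁ => by
        obtain ⟨hI, hF⟩ := hsup m s₁ h₁
        have e2 : s₁.nat 2 0 0 = k := (congrFun₂ (hF.1 2 rfl) 0 0).trans hk
        have e4 : s₁.nat 4 0 0 = j := (congrFun₂ (hF.1 4 rfl) 0 0).trans hj
        exact wexp_sampleCell (s := (s₁.setNat 5 0 0 m).tick 1) (by simpa using e2)
          (by simpa using e4) (by simp [hI, hF.2 1 rfl, hr, hPdef]) hq0 hq1 Φ]
      simp only [State.tick_nat, State.setNat_nat, and_self, if_true]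
      simp only [OfNat.zero_ne_ofNat, false_and, if_false]
      rw [wexp_add, wexp_const, wexp_const_mul, mul_add, ← mul_assoc, ← mul_assoc,
        ← ENNReal.ofReal_mul (by linarith), ← ENNReal.ofReal_mul (by linarith), add_comm]
      -- If the prefix mass is still 0, the bias is 0/0 = 0 and both sides vanish.
      rcases (add_nonneg hP hpm).eq_or_lt with hz | hz
      · have hz1 : s.real 1 j m = 0 := by linarith
        have hz2 : P = 0 := by linarith
        simp [hz1, hz2]
      · rw [mul_div_cancel₀ _ hz.ne', mul_sub, mul_one, mul_div_cancel₀ _ hz.ne',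
          add_sub_cancel_right]
  have := key (numLabels k) le_rfl
  rwa [h1, ENNReal.ofReal_one, one_mul] at this

theorem wexp_labelLaw {p : Fin (numLabels k) → ℝ} (hp : IsDist p)
    (Φ : Fin (numLabels k) → ℝ≥0∞) :
    wexp (labelLaw p hp) Φ = ∑ i, ENNReal.ofReal (p i) * Φ i := by
  rw [wexp, tsum_fintype]
  rfl

theorem wexp_sampleRow_of_holds {s : State} (hk : s.nat 2 0 0 = k) {j : Fin n}
    (hj : s.nat 4 0 0 = j) {G : Fin n → Fin (numLabels k) → ℝ} (hG : Holds G s j)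
    (Φ : Fin (k + 1) → ℝ≥0∞) :
    wexp (exec n k f sampleRow s) (fun s' => Φ (s'.vec n k 0 j))
      = wexp (labelLaw (mix (posDist (G j))) (mix_posDist_isDist (G j))) fun i => Φ (high i) := by
  have hp := mix_posDist_isDist (G j)
  have h1 : ∑ i ∈ Finset.range (numLabels k), s.real 1 j i = 1 := by
    rw [← hp.2, ← Fin.sum_univ_eq_sum_range]
    exact Finset.sum_congr rfl fun i _ => (hG i).2.1
  have := wexp_sampleRow (f := f) hk hj
    (fun i hi => by rw [(hG ⟨i, hi⟩).2.1]; exact hp.1 _) h1 (fun v => Φ (clip k v))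
  rw [wexp_labelLaw]
  refine this.trans ?_
  rw [← Fin.sum_univ_eq_sum_range
    (fun i => ENNReal.ofReal (s.real 1 j i) * Φ (clip k (highNat k i)))]
  exact Finset.sum_congr rfl fun i _ => by rw [(hG i).2.1]; rfl

theorem nat_zero_sampleRow {s s' : State} (h : s' ∈ (exec n k f sampleRow s).support) {l : ℕ}
    (hl : l ≠ s.nat 4 0 0) : s'.nat 0 0 l = s.nat 0 0 l := by
  obtain ⟨s₀, h0, h⟩ := mem_support_seq.mp h
  have F0 := frame_exec h0
  rw [← F0.1 0 rfl]
  rw [← F0.1 4 rfl] at hl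
  refine forLoop_induction (I := fun _ s₁ => s₁.nat 0 0 l = s₀.nat 0 0 l) rfl rfl
    (fun m _ s₁ hF hI s₂ h2 => ?_) s' h
  rw [← hI]
  rw [← hF.1 4 rfl] at hl
  obtain ⟨s₃, h3, h4⟩ := mem_support_seq.mp h2
  obtain ⟨s₄, h4, h5⟩ := mem_support_seq.mp h4
  have F3 := frame_exec h3
  have F4 := frame_exec h4
  have e0 : s₄.nat 0 0 l = s₁.nat 0 0 l := by
    rw [F4.1 0 rfl, F3.1 0 rfl]; simp
  have e4 : s₄.nat 4 0 0 = s₁.nat 4 0 0 := by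
    rw [F4.1 4 rfl, F3.1 4 rfl]; simp
  rw [← e0]
  rcases mem_support_iteNat h5 with ⟨-, h6⟩ | ⟨-, h6⟩
  · rw [(mem_support_setNat h6).1]
    simp [e4, hl]
  · rw [(mem_support_skip h6).1]
    rfl

/-- The law of the vector in array `0` after `play`. -/
theorem map_vec_play {s : State} (hs : HasParams n k s) {G : Fin n → Fin (numLabels k) → ℝ}
    (hG : ∀ j, Holds G s j) :
    (exec n k f algorithm.play s).map (fun s' => s'.vec n k 0) = playLaw G := by
  have hmem : ∀ m, ∀ s' ∈ (iterate (loopBody n k f 4 sampleRow) m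
      (s.tick ((cell 1).cost + 1))).support, Frame (.forLoop 4 (cell 1) sampleRow) s s' :=
    fun m s' hs' => (iterate_frame_induction (I := fun _ _ => True) (cell 1) trivial
      (fun _ _ _ _ _ _ _ => trivial) s' hs').2
  -- Array 0 still holds the previous play beyond coordinate m; `splice` masks these stale entries
  -- by 0, matching the unlabeled entries of the sampled labeling.
  have key : ∀ m ≤ n, ∀ Φ : Vec n k → ℝ≥0∞,
      wexp (iterate (loopBody n k f 4 sampleRow) m (s.tick ((cell 1).cost + 1)))
        (fun s' => Φ (splice m (s'.vec n k 0) fun _ => 0))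
      = wexp (seqLaw (fun j => mix (posDist (G j))) (fun j => mix_posDist_isDist (G j)) m)
        fun ξ => Φ (fill 0 ξ) := by
    intro m hm
    induction m with
    | zero =>
      intro Φ
      rw [iterate, wexp_pure, seqLaw, wexp_pure]
      congr 1
    | succ m ih =>
      intro Φ
      rw [iterate, seqLaw_succ _ _ hm, wexp_bind, wexp_bind]
      simp only [wexp_map, fill_update]
      rw [← ih (by omega) fun x => wexp (labelLaw (mix (posDist (G ⟨m, hm⟩)))
        (mix_posDist_isDist (G ⟨m, hm⟩))) fun i => Φ (Function.update x ⟨m, hm⟩ (high i))]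
      refine wexp_congr fun s₁ h1 => ?_
      have hF := hmem m s₁ h1
      set s₀ := (s₁.setNat 4 0 0 m).tick 1 with hs₀
      have hk₀ : s₀.nat 2 0 0 = k := by
        simpa [hs₀] using (congrFun₂ (hF.1 2 rfl) 0 0).trans hs.label
      have hG₀ : Holds G s₀ ⟨m, hm⟩ := (hG ⟨m, hm⟩).congr fun a ha => by
        have : s₀.real a = s₁.real a := rfl
        rw [this]
        interval_cases a
        · rw [hF.2 0 rfl]
        · rw [hF.2 1 rfl]
        · rw [hF.2 2 rfl]
      rw [← wexp_sampleRow_of_holds (f := f) hk₀ (by simp [hs₀]) hG₀ fun v =>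
        Φ (Function.update (splice m (s₁.vec n k 0) fun _ => 0) ⟨m, hm⟩ v)]
      refine wexp_congr fun s₂ h2 => ?_
      congr 1
      funext l
      by_cases hl : l = ⟨m, hm⟩
      · subst hl; simp [splice]
      · have hlm : (l : ℕ) ≠ m := fun h => hl (Fin.ext h)
        have hiff : (l : ℕ) < m + 1 ↔ (l : ℕ) < m := by omega
        rw [Function.update_of_ne hl, splice, splice, State.vec_apply, State.vec_apply,
          nat_zero_sampleRow h2 (by simpa [hs₀] using hlm)]
        simp [hiff]
  refine PMF.ext fun x => ?_
  have hx := key n le_rfl fun y => if x = y then 1 else 0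
  have hsp : ∀ y : Vec n k, splice n y (fun _ => 0) = y := fun y => by funext l; simp [splice]
  simp only [hsp] at hx
  have he : exec n k f algorithm.play s = iterate (loopBody n k f 4 sampleRow) n
      (s.tick ((cell 1).cost + 1)) := by
    rw [show algorithm.play = .forLoop 4 (cell 1) sampleRow from rfl, exec_forLoop, eval_cell,
      hs.dim]
  rw [map_apply_eq_wexp, playLaw, map_apply_eq_wexp, he]
  exact hx

end Sampling

/-! ### The algorithm in the online protocol -/

section Protocol

variable {n k : ℕ}

theorem paramLoops_init : algorithm.init.ParamLoops := by
  simp +contextual [algorithm, prepRow, posLoop, normLoop, normCell, excessCell, mixLoop,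
    Cmd.ParamLoops, Cmd.keepsNat]

theorem paramLoops_play : algorithm.play.ParamLoops := by
  simp +contextual [algorithm, sampleRow, sampleCell, Cmd.ParamLoops, Cmd.keepsNat]

theorem paramLoops_update : algorithm.update.ParamLoops := by
  simp +contextual [algorithm, prepRow, posLoop, normLoop, normCell, excessCell, mixLoop,
    regretRow, gainLoop, gainCell, queryLoop, regretLoop, Cmd.ParamLoops, Cmd.keepsNat]

theorem hasParams_initialState (n k T : ℕ) : HasParams n k (initialState n k T) := by
  constructor <;> rfl

/-- The memory is a function of the plays as far as the regrets, probabilities and coefficients go;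
hence the law of the next play depends on the past through the plays only. -/
theorem run_invariant (adv : Adversary n k) (T t : ℕ) :
    ∀ p ∈ (algorithm.run n k T adv t).support,
      HasParams n k p.1 ∧ ∀ j, Holds (cumReg adv t p.2) p.1 j := by
  induction t with
  | zero =>
    intro p hp
    obtain ⟨s, hs, rfl⟩ := (PMF.mem_support_map_iff _ _ _).mp hp
    exact ⟨(hasParams_initialState n k T).exec paramLoops_init hs,
      init_spec (hasParams_initialState n k T) rfl hs⟩
  | succ t ih =>
    intro p hp
    rw [OnlineAlgorithm.run, PMF.mem_support_bind_iff] at hp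
    obtain ⟨q, hq, hp⟩ := hp
    rw [PMF.mem_support_bind_iff] at hp
    obtain ⟨s, hs, hp⟩ := hp
    obtain ⟨s', hs', rfl⟩ := (PMF.mem_support_map_iff _ _ _).mp hp
    obtain ⟨h1, h2⟩ := ih q hq
    have h3 := h1.exec paramLoops_play hs
    refine ⟨h3.exec paramLoops_update hs', fun j => ?_⟩
    have hF := frame_exec hs
    have h4 : ∀ j, Holds (cumReg adv t q.2) s j := fun j => (h2 j).congr fun a ha => by
      interval_cases a
      · rw [hF.2 0 rfl]
      · rw [hF.2 1 rfl]
      · rw [hF.2 2 rfl]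
    have h5 := update_spec h3 h4 hs' j
    have e1 : cumReg adv (t + 1) (Fin.snoc q.2 (s.vec n k 0) : Fin (t + 1) → Vec n k)
        = fun j i => cumReg adv t q.2 j i
          + regretInc (posDist (cumReg adv t q.2 j)) (marg (adv t q.2) (s.vec n k 0) j) i := by
      funext j i
      simp only [cumReg, Fin.init_snoc, Fin.snoc_last]
    simp only [e1]
    exact h5

theorem map_snd_run (adv : Adversary n k) (T t : ℕ) :
    (algorithm.run n k T adv t).map Prod.snd = idealLaw adv t := by
  induction t with
  | zero =>
    rw [OnlineAlgorithm.run, PMF.map_comp, idealLaw]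
    exact PMF.map_const _ _
  | succ t ih =>
    rw [OnlineAlgorithm.run, PMF.map_bind, idealLaw, ← ih, PMF.bind_map]
    refine PMF.ext fun x => ?_
    rw [PMF.bind_apply, PMF.bind_apply]
    refine tsum_congr fun p => ?_
    by_cases hp : p ∈ (algorithm.run n k T adv t).support
    · obtain ⟨h1, h2⟩ := run_invariant adv T t p hp
      congr 2
      rw [Function.comp_apply, ← map_vec_play (f := fun _ => 0) h1 h2, PMF.map_comp,
        PMF.map_bind, ← PMF.bind_pure_comp]
      congr 1
      funext s
      rw [PMF.map_comp]
      -- The play is fixed before the update is run, so the law of the updated memory is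
      -- marginalized out.
      exact PMF.map_const _ _
    · rw [(PMF.apply_eq_zero_iff _ p).mpr hp, zero_mul, zero_mul]

theorem expectedRegret_algorithm (adv : Adversary n k) (T : ℕ) (α : ℝ) :
    algorithm.expectedRegret n k T α adv = expect (idealLaw adv T) (regret α adv) := by
  rw [OnlineAlgorithm.expectedRegret, map_snd_run]
  rfl

theorem numLabels_le (hk : 1 ≤ k) : k + (2 - k) ≤ 2 * (n + k) := by omega

theorem pow_le_cube {N : ℕ} (hN : 1 ≤ N) : 1 ≤ N ^ 3 ∧ N ≤ N ^ 3 ∧ N ^ 2 ≤ N ^ 3 :=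
  ⟨Nat.one_le_pow _ _ hN, Nat.le_self_pow (by norm_num) N, Nat.pow_le_pow_right hN (by norm_num)⟩

theorem bound_init_le (hk : 1 ≤ k) : algorithm.init.bound n k ≤ 1000 * (n + k) ^ 3 := by
  simp only [algorithm, prepRow, posLoop, normLoop, normCell, excessCell, mixLoop, Cmd.bound,
    NExpr.cost, RExpr.cost, cell, realCell, realRow, realMat, labelsExpr, NExpr.eval, initialState,
    and_self, if_true, OfNat.ofNat_ne_one, if_false]
  have hK := numLabels_le (n := n) hk
  have hn : n ≤ n + k := Nat.le_add_right n k
  have hN : 1 ≤ n + k := by omega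
  generalize n + k = N at *
  generalize k + (2 - k) = K at *
  obtain ⟨h1, h2, h3⟩ := pow_le_cube hN
  have h4 : n * K ≤ N * (2 * N) := Nat.mul_le_mul hn hK
  nlinarith

theorem bound_play_le (hk : 1 ≤ k) : algorithm.play.bound n k ≤ 1000 * (n + k) ^ 3 := by
  simp only [algorithm, sampleRow, sampleCell, Cmd.bound, highExpr, lowExpr,
    NExpr.cost, RExpr.cost, cell, realCell, realMat, labelsExpr, NExpr.eval, initialState,
    and_self, if_true, OfNat.ofNat_ne_one, if_false]
  have hK := numLabels_le (n := n) hk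
  have hn : n ≤ n + k := Nat.le_add_right n k
  have hN : 1 ≤ n + k := by omega
  generalize n + k = N at *
  generalize k + (2 - k) = K at *
  obtain ⟨h1, h2, h3⟩ := pow_le_cube hN
  have h4 : n * K ≤ N * (2 * N) := Nat.mul_le_mul hn hK
  nlinarith

/-- The cubic term comes from coordinates × labels × the n steps for building and querying a vector;
the constant is generous. -/
theorem bound_update_le (hk : 1 ≤ k) : algorithm.update.bound n k ≤ 1000 * (n + k) ^ 3 := by
  simp only [algorithm, prepRow, posLoop, normLoop, normCell, excessCell, mixLoop, Cmd.bound,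
    regretRow, gainLoop, gainCell, queryLoop, regretLoop, highExpr, lowExpr,
    NExpr.cost, RExpr.cost, cell, realCell, realRow, realMat, labelsExpr, NExpr.eval, initialState,
    and_self, if_true, OfNat.ofNat_ne_one, if_false]
  have hK := numLabels_le (n := n) hk
  have hn : n ≤ n + k := Nat.le_add_right n k
  have hN : 1 ≤ n + k := by omega
  generalize n + k = N at *
  generalize k + (2 - k) = K at *
  obtain ⟨h1, h2, h3⟩ := pow_le_cube hN
  have h4 : n * K ≤ N * (2 * N) := Nat.mul_le_mul hn hK
  have h5 : n * (n * K) ≤ N * (N * (2 * N)) := Nat.mul_le_mul hn h4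
  nlinarith

theorem polynomialTime_algorithm : algorithm.PolynomialTime := by
  -- A round consists of `play` and `update`, each within 1000 (n + k)³ steps.
  refine ⟨2000, 3, fun n k T hk adv _ => ⟨fun s hs => ?_, fun t _ p hp s hs s' hs' => ?_⟩⟩
  · have h1 := steps_le_bound paramLoops_init (hasParams_initialState n k T) hs
    have h2 := bound_init_le (n := n) hk
    have h3 : (initialState n k T).steps = 0 := rfl
    linarith
  · have h0 := (run_invariant adv T t p hp).1
    have h1 := steps_le_bound paramLoops_play h0 hs
    have h2 := steps_le_bound paramLoops_update (h0.exec paramLoops_play hs) hs'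
    have h3 := bound_play_le (n := n) hk
    have h4 := bound_update_le (n := n) hk
    linarith

end Protocol

end OnlineKSubmod

end

theorem mainTheorem1 :
    ∃ A : OnlineKSubmod.OnlineAlgorithm, A.PolynomialTime ∧
      ∃ C : ℝ, ∀ (n k T : ℕ), 1 ≤ k → ∀ adv : OnlineKSubmod.Adversary n k, adv.Valid →
        A.expectedRegret n k T (1 / 2) adv ≤ C * (k * n * Real.sqrt T) := by
  refine ⟨OnlineKSubmod.algorithm, OnlineKSubmod.polynomialTime_algorithm, 6,
    fun n k T hk adv hadv => ?_⟩
  rw [OnlineKSubmod.expectedRegret_algorithm]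
  exact OnlineKSubmod.expect_regret_le hk hadv T
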